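/- Let $d,\beta>0$ and $B\ge 0$ be real numbers. For $t\in[0,1]$ let the coupled Belief Propagation operator $\mathrm{BP}^\otimes_{d,\beta,B,t}$ map a probability measure $\pi$ on $[-1,1]^2$ to the distribution of the random vector $$\left(\frac{\sum_{s\in\{\pm1\}}s\,e^{sB}\prod_{i=1}^{\mathbf d^{(0)}}\bigl(1+s\mu^{(0)}_{i,h}\tanh\beta\bigr)\prod_{i=1}^{\mathbf d^{(h)}}\bigl(1+s\mu^{(h)}_{i,h}\tanh\beta\bigr)}{\sum_{s\in\{\pm1\}}e^{sB}\prod_{i=1}^{\mathbf d^{(0)}}\bigl(1+s\mu^{(0)}_{i,h}\tanh\beta\bigr)\prod_{i=1}^{\mathbf d^{(h)}}\bigl(1+s\mu^{(h)}_{i,h}\tanh\beta\bigr)}\right)_{h=1,2},$$ where $\mathbf d^{(0)}\sim\mathrm{Po}(dt)$, $\mathbf d^{(1)},\mathbf d^{(2)}\sim\mathrm{Po}(d(1-t))$, and $\mu^{(\tau)}_i=(\mu^{(\tau)}_{i,1},\mu^{(\tau)}_{i,2})\sim\pi$ for $\tau\in\{0,1,2\}$, $i\ge1$, all mutually independent.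 Write $\mathrm{BP}^{\otimes\,\ell}_{d,\beta,B,t}$ for its $\ell$-fold iterate, $\delta_{(1,1)}$ for the point mass at $(1,1)$, and $W_1$ for the $L^1$-Wasserstein distance on $[-1,1]^2$ with respect to the norm $\|\cdot\|_1$. Let $\mathbb T^\otimes=\mathbb T^\otimes(d,t)$ be the Galton–Watson tree with vertex types $0,1,2$ whose root has type $0$, in which a type-$0$ vertex has independently $\mathrm{Po}(dt)$ children of type $0$, $\mathrm{Po}(d(1-t))$ of type $1$ and $\mathrm{Po}(d(1-t))$ of type $2$, while for $h=1,2$ a type-$h$ vertex has $\mathrm{Po}(d)$ children, all of type $h$. For $h=1,2$ let $\mathbb T^\otimes[h]$ be the subtree obtained by deleting all vertices of type $3-h$. Let $R_\ell(h)$ be the expected spin of the root under the Ising model with inverse temperature $\beta$ and external field $B$ on the truncation of $\mathbb T^\otimes[h]$ at depth $\ell$, conditioned on all vertices at distance exactly $\ell$ from the root having spin $+1$. Then for each $t\in[0,1]$ there is a probability measure $\pi^\otimes_{d,\beta,B,t}$ on $[-1,1]^2$ such that the following statements hold. 1. For every $t\in[0,1]$, $\mathrm{BP}^{\otimes\,\ell}_{d,\beta,B,t}(\delta_{(1,1)})\to\pi^\otimes_{d,\beta,B,t}$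 as $\ell\to\infty$, weakly and in $W_1$. 2. For every $t\in[0,1]$ and $\ell\ge0$, $\mathrm{BP}^{\otimes\,\ell}_{d,\beta,B,t}(\delta_{(1,1)})$ is the distribution of $(R_\ell(1),R_\ell(2))$. Moreover, for every $t\in[0,1]$ the pair $(R_\ell(1),R_\ell(2))$ converges almost surely as $\ell\to\infty$, and $\pi^\otimes_{d,\beta,B,t}$ is the distribution of its limit. 3. The map $t\in[0,1]\mapsto\pi^\otimes_{d,\beta,B,t}$ is continuous with respect to $W_1$. -/

import Mathlib

open MeasureTheory ProbabilityTheory Filter Topology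
open scoped NNReal ENNReal

noncomputable section

namespace CoupledIsing

/-! ## The square, the Wasserstein distance -/

/-- The square `[-1,1]²`; its two coordinates `h = 1, 2` are indexed by `0, 1 : Fin 2`. -/
abbrev Square : Type := Fin 2 → Set.Icc (-1 : ℝ) 1

/-- The corner `(1,1)` of the square. -/
def corner : Square := fun _ => ⟨1, by norm_num, le_refl _⟩

/-- The `L¹`-Wasserstein distance of two probability measures on the square with respect to the
`ℓ¹`-norm: the infimum of `∫ ‖x - y‖₁ dγ(x, y)` over all couplings `γ` of `μ` and `ν`. -/
def wasserstein1 (μ ν : ProbabilityMeasure Square) : ℝ≥0∞ :=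
  ⨅ (γ : Measure (Square × Square)) (_ : γ.fst = μ) (_ : γ.snd = ν),
    ∫⁻ p, ENNReal.ofReal (∑ h, |(p.1 h : ℝ) - (p.2 h : ℝ)|) ∂γ

/-! ## The coupled Belief Propagation operator -/

/-- Mean number of type `τ` children of a vertex of type `σ` in the three-type Galton-Watson
tree.  The rows and columns are indexed by the types `0, 1, 2`. -/
def offspringRate (d : ℝ) (t : unitInterval) (σ τ : Fin 3) : ℝ≥0 :=
  Real.toNNReal (!![d * (t : ℝ), d * (1 - (t : ℝ)), d * (1 - (t : ℝ));
                    0,           d,                 0;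
                    0,           0,                 d] σ τ)

/-- Joint law of the variables that enter the coupled Belief Propagation operator: independent
Poisson variables of means `d t`, `d (1 - t)`, `d (1 - t)`, and, independent of these, a family
indexed by `(τ, i) : Fin 3 × ℕ` of independent samples from `π`. -/
def bpInput (d : ℝ) (t : unitInterval) (π : ProbabilityMeasure Square) :
    Measure ((Fin 3 → ℕ) × (Fin 3 × ℕ → Square)) :=
  (Measure.pi fun τ => poissonMeasure (offspringRate d t 0 τ)).prod
    (Measure.infinitePi fun _ : Fin 3 × ℕ => (π : Measure Square))

instance (d : ℝ) (t : unitInterval) (π : ProbabilityMeasure Square) :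
    IsProbabilityMeasure (bpInput d t π) := by
  unfold bpInput; infer_instance

/-- The weight `exp(s B) ∏ (1 + s μ_{i,h}^{(0)} tanh β) ∏ (1 + s μ_{i,h}^{(h)} tanh β)` of the
spin `s = ±1`.  The value `h.succ : Fin 3` is the type `1` or `2` that belongs to the coordinate
`h`. -/
def bpWeight (β B : ℝ) (x : (Fin 3 → ℕ) × (Fin 3 × ℕ → Square)) (h : Fin 2) (s : ℝ) : ℝ :=
  Real.exp (s * B)
    * (∏ i ∈ Finset.range (x.1 0), (1 + s * (x.2 (0, i) h : ℝ) * Real.tanh β))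
    * (∏ i ∈ Finset.range (x.1 h.succ), (1 + s * (x.2 (h.succ, i) h : ℝ) * Real.tanh β))

/-- The quotient of the sums over `s = ±1` of `s` times the weight and of the weight. -/
def bpRatio (β B : ℝ) (x : (Fin 3 → ℕ) × (Fin 3 × ℕ → Square)) (h : Fin 2) : ℝ :=
  (bpWeight β B x h 1 - bpWeight β B x h (-1)) / (bpWeight β B x h 1 + bpWeight β B x h (-1))

lemma bpFactor_pos (β : ℝ) (y : Set.Icc (-1 : ℝ) 1) {s : ℝ} (hs : |s| = 1) :
    0 < 1 + s * (y : ℝ) * Real.tanh β := by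
  have h1 : |s * (y : ℝ) * Real.tanh β| < 1 := by
    rw [abs_mul, abs_mul, hs, one_mul]
    have hy : |(y : ℝ)| ≤ 1 := abs_le.mpr ⟨y.2.1, y.2.2⟩
    have ht := Real.abs_tanh_lt_one β
    nlinarith [abs_nonneg (y : ℝ), abs_nonneg (Real.tanh β)]
  linarith [(abs_lt.mp h1).1]

lemma bpWeight_pos (β B : ℝ) (x : (Fin 3 → ℕ) × (Fin 3 × ℕ → Square)) (h : Fin 2) {s : ℝ}
    (hs : |s| = 1) : 0 < bpWeight β B x h s :=
  mul_pos (mul_pos (Real.exp_pos _) (Finset.prod_pos fun _ _ => bpFactor_pos β _ hs))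
    (Finset.prod_pos fun _ _ => bpFactor_pos β _ hs)

lemma bpRatio_mem (β B : ℝ) (x : (Fin 3 → ℕ) × (Fin 3 × ℕ → Square)) (h : Fin 2) :
    bpRatio β B x h ∈ Set.Icc (-1 : ℝ) 1 := by
  have h1 := bpWeight_pos β B x h (s := 1) (by simp)
  have h2 := bpWeight_pos β B x h (s := -1) (by simp)
  unfold bpRatio
  constructor
  · rw [le_div_iff₀ (by linarith)]; linarith
  · rw [div_le_one (by linarith)]; linarith

/-- The random vector whose law is the image of `π` under the coupled operator. -/
def bpMap (β B : ℝ) (x : (Fin 3 → ℕ) × (Fin 3 × ℕ → Square)) : Square :=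
  fun h => ⟨bpRatio β B x h, bpRatio_mem β B x h⟩

lemma measurable_bpMap (β B : ℝ) : Measurable (bpMap β B) := by
  have hw : ∀ (h : Fin 2) (s : ℝ), Measurable fun x => bpWeight β B x h s := by
    intro h s
    refine measurable_from_prod_countable_right fun n => ?_
    unfold bpWeight
    refine Measurable.mul (Measurable.mul measurable_const ?_) ?_
    all_goals
      refine Finset.measurable_fun_prod (Finset.range _) fun i _ => ?_
      fun_prop
  refine measurable_pi_lambda _ fun h => Measurable.subtype_mk ?_
  exact ((hw h 1).sub (hw h (-1))).div ((hw h 1).add (hw h (-1)))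

/-- The coupled Belief Propagation operator on the probability measures on `[-1,1]²`. -/
def coupledBP (d β B : ℝ) (t : unitInterval) (π : ProbabilityMeasure Square) :
    ProbabilityMeasure Square :=
  ProbabilityMeasure.map ⟨bpInput d t π, inferInstance⟩ (measurable_bpMap β B).aemeasurable

/-- The `ℓ`-fold application of the coupled operator to the atom at `(1,1)`. -/
def bpIterate (d β B : ℝ) (t : unitInterval) (ℓ : ℕ) : ProbabilityMeasure Square :=
  (coupledBP d β B t)^[ℓ] (diracProba corner)

/-- A probability measure on the square, regarded as a measure on `ℝ²`. -/
def toPlane (π : ProbabilityMeasure Square) : Measure (Fin 2 → ℝ) :=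
  (π : Measure Square).map fun x h => (x h : ℝ)

/-! ## The Ising model on a finite graph, with a `+1` boundary condition -/

section Ising

variable {V : Type*} [Fintype V] [DecidableEq V]

/-- The value in `ℝ` of a spin; the spin space `{±1}` is `ℤˣ`. -/
def spin (s : ℤˣ) : ℝ := ((s : ℤ) : ℝ)

open Classical in
/-- The unnormalised weight `exp(β ∑_{e ∈ E} σ(e) + B ∑_{v ∈ V} σ(v))`, where
`σ({v,w}) = σ(v) σ(w)`. -/
def isingWeight (G : SimpleGraph V) (β B : ℝ) (σ : V → ℤˣ) : ℝ :=
  Real.exp (β * (∑ e ∈ G.edgeFinset, spin (e.map σ).mul) + B * ∑ v, spin (σ v))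

/-- The Ising model on the finite graph `G`. -/
def ising (G : SimpleGraph V) (β B : ℝ) (σ : V → ℤˣ) : ℝ :=
  isingWeight G β B σ / ∑ τ : V → ℤˣ, isingWeight G β B τ

/-- All vertices at distance exactly `ℓ` from `r` carry the spin `+1`. -/
def PlusBoundary (G : SimpleGraph V) (r : V) (ℓ : ℕ) (σ : V → ℤˣ) : Prop :=
  ∀ v, G.edist r v = ℓ → σ v = 1

open Classical in
/-- The Ising model conditioned on the event that all vertices at distance exactly `ℓ` from the
root `r` carry the spin `+1`. -/
def isingPlus (G : SimpleGraph V) (r : V) (ℓ : ℕ) (β B : ℝ) (σ : V → ℤˣ) : ℝ :=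
  if PlusBoundary G r ℓ σ then
    ising G β B σ / ∑ τ : V → ℤˣ, if PlusBoundary G r ℓ τ then ising G β B τ else 0
  else 0

/-- The expected spin of the root under the conditioned Ising model. -/
def rootMagnetisation (G : SimpleGraph V) (r : V) (ℓ : ℕ) (β B : ℝ) : ℝ :=
  ∑ σ : V → ℤˣ, spin (σ r) * isingPlus G r ℓ β B σ

end Ising

/-! ## The three-type Galton-Watson tree -/

/-- Possible vertices of the tree.  The empty word is the root, and the word
`[(τ₁, i₁), …, (τₖ, iₖ)]` is reached from the root by passing to the child number `i₁` of type
`τ₁`, then to its child number `i₂` of type `τ₂`, and so on. -/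
abbrev Word : Type := List (Fin 3 × ℕ)

/-- The type of a vertex: `0` for the root, otherwise the type of the last letter. -/
def vertexType (w : Word) : Fin 3 := w.foldl (fun _ c => c.1) 0

/-- The graph on all words in which each nonempty word is joined to its parent. -/
def wordGraph : SimpleGraph Word where
  Adj u v := (∃ c, v = u ++ [c]) ∨ (∃ c, u = v ++ [c])
  symm := ⟨fun _ _ h => h.symm⟩
  loopless := ⟨fun u h => by rcases h with ⟨c, h⟩ | ⟨c, h⟩ <;> simp at h⟩

/-- A realisation of all offspring numbers: `N (w, τ)` is the number of children of type `τ` of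
the vertex `w`. -/
abbrev Offspring : Type := Word × Fin 3 → ℕ

/-- The law of the offspring numbers: they are independent Poisson variables whose means are
determined by the types of the parent and of the children. -/
def gwMeasure (d : ℝ) (t : unitInterval) : Measure Offspring :=
  Measure.infinitePi fun p : Word × Fin 3 =>
    poissonMeasure (offspringRate d t (vertexType p.1) p.2)

/-- The vertices of the tree at distance `k` from the root. -/
def level (N : Offspring) : ℕ → Finset Word
  | 0 => {[]}
  | k + 1 => (level N k).biUnion fun w => Finset.univ.biUnion fun τ : Fin 3 =>
      (Finset.range (N (w, τ))).image fun i => w ++ [(τ, i)]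

/-- The vertices of the subtree with index `h`, truncated at depth `ℓ`: only vertices of the types
`0` and `h.succ` are kept, so the vertices of the third type are deleted. -/
def truncVertices (N : Offspring) (h : Fin 2) (ℓ : ℕ) : Finset Word :=
  ((Finset.range (ℓ + 1)).biUnion (level N)).filter
    fun w => vertexType w = 0 ∨ vertexType w = h.succ

/-- The subtree with index `h`, truncated at depth `ℓ`. -/
def truncTree (N : Offspring) (h : Fin 2) (ℓ : ℕ) : SimpleGraph (truncVertices N h ℓ) :=
  wordGraph.comap Subtype.val

/-- The root of the truncated subtree. -/
def truncRoot (N : Offspring) (h : Fin 2) (ℓ : ℕ) : truncVertices N h ℓ :=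
  ⟨[], by
    simp only [truncVertices, Finset.mem_filter, Finset.mem_biUnion, Finset.mem_range]
    exact ⟨⟨0, by omega, by simp [level]⟩, Or.inl rfl⟩⟩

/-- The root magnetisations of the two subtrees, subject to the `+1` boundary condition at
distance `ℓ` from the root. -/
def treeMagnetisation (β B : ℝ) (ℓ : ℕ) (N : Offspring) (h : Fin 2) : ℝ :=
  rootMagnetisation (truncTree N h ℓ) (truncRoot N h ℓ) ℓ β B

end CoupledIsing

end

/-! On a finite tree the partition functions with prescribed root spin factor over the branches at
the root. The root magnetisation with plus boundary therefore satisfies the recursion `mag`, whose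
step is `bpMap`. This identification (`TypeConsistent.treeMagnetisation_eq`) holds almost surely,
namely whenever the offspring numbers of mean zero vanish.

In law, the subtrees at the children have roots of types 0, 1, 2, whereas the operator feeds the
same measure to all three. The replacement is harmless: a child of type `h.succ` enters only through
coordinate `h`, and that coordinate has the same law for root types 0 and `h.succ`. Indeed Po(dt)
plus an independent Po(d(1-t)) is Po(d), so a single coordinate follows the uncoupled recursion
`plainBP`, which involves neither t nor the root type (`magLaw_map_eval`, `magLaw_eq_bpIterate`).

For nonnegative β the map `bpMap` is monotone. Starting from the largest point of the square, the
magnetisations decrease in the depth and converge on every realisation; dominated convergence gives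
weak and Wasserstein convergence to the law of the limit `magLim`.

For continuity all t are coupled by Poisson quantile functions of common uniform variables. At fixed
depth only finitely many offspring numbers matter, and almost surely each is locally constant near a
given s. The truncation error is uniform in t: by monotonicity the mean ℓ¹-distance from the limit
is a difference of means of single coordinates, and these do not depend on t
(`integral_sqDist_mag_eq`). A triangle inequality concludes. -/

noncomputable section

namespace CoupledIsing

/-! ### The Ising model on a root with disjoint branches -/

section TreeIsing

variable {V : Type*} [Fintype V] [DecidableEq V]

lemma spin_mul (a b : ℤˣ) : spin (a * b) = spin a * spin b := by
  simp [spin]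

open Classical in
/-- The edge sum of the Ising Hamiltonian is half the sum over ordered pairs. -/
lemma sum_edgeFinset_spin (G : SimpleGraph V) (σ : V → ℤˣ) :
    ∑ e ∈ G.edgeFinset, spin (e.map σ).mul
      = 1 / 2 * ∑ u, ∑ v, if G.Adj u v then spin (σ u) * spin (σ v) else 0 := by
  have h1 : ∑ e ∈ G.edgeFinset, ∑ d : G.Dart with d.edge = e, spin (d.edge.map σ).mul
      = ∑ d : G.Dart, spin (d.edge.map σ).mul :=
    Finset.sum_fiberwise_of_maps_to (fun d _ => by simp) _
  have h2 : ∀ e ∈ G.edgeFinset, ∑ d : G.Dart with d.edge = e, spin (d.edge.map σ).mul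
      = 2 * spin (e.map σ).mul := by
    intro e he
    rw [Finset.sum_congr rfl (g := fun _ => spin (e.map σ).mul), Finset.sum_const,
      G.dart_edge_fiber_card e (by simpa using he)]
    · simp
    · intro d hd
      rw [(Finset.mem_filter.mp hd).2]
  have h3 : ∑ d : G.Dart, spin (d.edge.map σ).mul
      = ∑ p : V × V, if G.Adj p.1 p.2 then spin (σ p.1) * spin (σ p.2) else 0 := by
    rw [← Finset.sum_filter]
    refine Finset.sum_bij' (fun d _ => d.toProd) (fun p hp => ⟨p, (Finset.mem_filter.mp hp).2⟩)
      ?_ ?_ ?_ ?_ ?_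
    · simp
    · simp
    · simp
    · simp
    · rintro ⟨⟨u, v⟩, huv⟩ _
      simp [SimpleGraph.Dart.edge, ← spin_mul]
  rw [Finset.sum_congr rfl h2, ← Finset.mul_sum] at h1
  rw [← Fintype.sum_prod_type' (f := fun u v => if G.Adj u v then spin (σ u) * spin (σ v) else 0),
    ← h3, ← h1]
  ring

open Classical in
/-- Partition function of the configurations with spin `s` at `r` and `+1` on the set `b`. -/
def restrictedSum (G : SimpleGraph V) (r : V) (b : V → Prop) (β B : ℝ) (s : ℤˣ) : ℝ :=
  ∑ σ : V → ℤˣ, if σ r = s ∧ ∀ v, b v → σ v = 1 then isingWeight G β B σ else 0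

lemma isingWeight_pos (G : SimpleGraph V) (β B : ℝ) (σ : V → ℤˣ) : 0 < isingWeight G β B σ :=
  Real.exp_pos _

lemma restrictedSum_nonneg (G : SimpleGraph V) (r : V) (b : V → Prop) (β B : ℝ) (s : ℤˣ) :
    0 ≤ restrictedSum G r b β B s := by
  refine Finset.sum_nonneg fun σ _ => ?_
  split_ifs
  · exact (isingWeight_pos ..).le
  · exact le_rfl

lemma restrictedSum_one_pos (G : SimpleGraph V) (r : V) (b : V → Prop) (β B : ℝ) :
    0 < restrictedSum G r b β B 1 := by
  refine Finset.sum_pos' (fun σ _ => ?_) ⟨fun _ => 1, Finset.mem_univ _, ?_⟩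
  · split_ifs
    · exact (isingWeight_pos ..).le
    · exact le_rfl
  · simp [isingWeight_pos]

/-- Expected root spin, given that all spins on `b` are `+1`. -/
def boundaryMag (G : SimpleGraph V) (r : V) (b : V → Prop) (β B : ℝ) : ℝ :=
  (restrictedSum G r b β B 1 - restrictedSum G r b β B (-1)) /
    (restrictedSum G r b β B 1 + restrictedSum G r b β B (-1))

lemma sum_units_int (f : ℤˣ → ℝ) : ∑ s, f s = f 1 + f (-1) := by
  have : (Finset.univ : Finset ℤˣ) = {1, -1} := by decide
  rw [this, Finset.sum_pair (by decide)]

-- Grouping by the root spin turns any weighted sum of a function of that spin into its two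
-- restricted partition functions. It serves both the conditional expectation at the root and the
-- edge factor between the root and a branch.
open Classical in
lemma sum_boundary_eq (G : SimpleGraph V) (r : V) (b : V → Prop) (β B : ℝ) (f : ℤˣ → ℝ) :
    ∑ σ : V → ℤˣ, (if ∀ v, b v → σ v = 1 then f (σ r) * isingWeight G β B σ else 0)
      = f 1 * restrictedSum G r b β B 1 + f (-1) * restrictedSum G r b β B (-1) := by
  rw [← sum_units_int (fun s => f s * restrictedSum G r b β B s)]
  simp only [restrictedSum, Finset.mul_sum]
  rw [Finset.sum_comm]
  refine Finset.sum_congr rfl fun σ _ => ?_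
  rw [Finset.sum_eq_single (σ r)]
  · simp
  · intro s _ hs
    simp [hs.symm]
  · exact fun h => absurd (Finset.mem_univ _) h

/-- The full partition function `Z` cancels between the conditioned weight and its normalisation. -/
lemma rootMagnetisation_eq_boundaryMag (G : SimpleGraph V) (r : V) (ℓ : ℕ) (β B : ℝ) :
    rootMagnetisation G r ℓ β B = boundaryMag G r (fun v => G.edist r v = ℓ) β B := by
  classical
  set b : V → Prop := fun v => G.edist r v = ℓ
  set Z := ∑ τ : V → ℤˣ, isingWeight G β B τ with hZ
  have hZpos : 0 < Z := Finset.sum_pos (fun _ _ => isingWeight_pos ..) Finset.univ_nonempty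
  have key : ∀ f : ℤˣ → ℝ, ∑ σ : V → ℤˣ, (if PlusBoundary G r ℓ σ then f (σ r) * ising G β B σ else 0)
      = (f 1 * restrictedSum G r b β B 1 + f (-1) * restrictedSum G r b β B (-1)) / Z := by
    intro f
    rw [← sum_boundary_eq, Finset.sum_div]
    refine Finset.sum_congr rfl fun σ _ => ?_
    simp only [PlusBoundary, ising, ← hZ, b]
    split_ifs <;> ring
  have hden := key (fun _ => 1)
  simp only [one_mul] at hden
  have hnum := key spin
  have h1 := restrictedSum_one_pos G r b β B
  have h2 := restrictedSum_nonneg G r b β B (-1)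
  unfold rootMagnetisation isingPlus
  rw [hden]
  calc _ = (∑ σ : V → ℤˣ, (if PlusBoundary G r ℓ σ then spin (σ r) * ising G β B σ else 0)) /
        ((restrictedSum G r b β B 1 + restrictedSum G r b β B (-1)) / Z) := by
        rw [Finset.sum_div]
        refine Finset.sum_congr rfl fun σ _ => ?_
        split_ifs <;> ring
    _ = _ := by
        rw [hnum]
        unfold boundaryMag
        rw [div_div_div_cancel_right₀ hZpos.ne']
        simp [spin]
        ring

variable {C : Type*} [Fintype C] [DecidableEq C] {W : C → Type*} [∀ c, Fintype (W c)]
  [∀ c, DecidableEq (W c)]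

/-- A graph on `V` decomposes, via `e`, into a root and disjoint branches `G c`, the root being
joined exactly to the roots `r c` of the branches. -/
structure IsBranching (G : SimpleGraph V) (Gc : ∀ c, SimpleGraph (W c)) (rc : ∀ c, W c)
    (e : Option (Σ c, W c) ≃ V) : Prop where
  root_adj : ∀ c v, G.Adj (e none) (e (some ⟨c, v⟩)) ↔ v = rc c
  adj_same : ∀ c u v, G.Adj (e (some ⟨c, u⟩)) (e (some ⟨c, v⟩)) ↔ (Gc c).Adj u v
  adj_ne : ∀ c c' u v, c ≠ c' → ¬ G.Adj (e (some ⟨c, u⟩)) (e (some ⟨c', v⟩))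

lemma IsBranching.isingWeight_eq {G : SimpleGraph V} {Gc : ∀ c, SimpleGraph (W c)}
    {rc : ∀ c, W c} {e : Option (Σ c, W c) ≃ V} (hG : IsBranching G Gc rc e) (β B : ℝ)
    (σ : V → ℤˣ) :
    isingWeight G β B σ = Real.exp (B * spin (σ (e none))) *
      ∏ c, (Real.exp (β * (spin (σ (e none)) * spin (σ (e (some ⟨c, rc c⟩))))) *
        isingWeight (Gc c) β B fun v => σ (e (some ⟨c, v⟩))) := by
  classical
  simp only [isingWeight, sum_edgeFinset_spin, ← Real.exp_add, ← Real.exp_sum]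
  congr 1
  have hsum : ∀ f : V → ℝ, ∑ v, f v = f (e none) + ∑ c, ∑ v : W c, f (e (some ⟨c, v⟩)) := by
    intro f
    rw [← e.sum_comp, Fintype.sum_option, Fintype.sum_sigma]
  have hloop : ¬ G.Adj (e none) (e none) := G.irrefl
  have hdiag : ∀ c (u : W c), ∑ c', ∑ v : W c', (if G.Adj (e (some ⟨c, u⟩)) (e (some ⟨c', v⟩)) then
      spin (σ (e (some ⟨c, u⟩))) * spin (σ (e (some ⟨c', v⟩))) else 0)
      = ∑ v : W c, (if (Gc c).Adj u v then
      spin (σ (e (some ⟨c, u⟩))) * spin (σ (e (some ⟨c, v⟩))) else 0) := by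
    intro c u
    rw [Finset.sum_eq_single c]
    · simp only [hG.adj_same]
    · intro c' _ hc'
      refine Finset.sum_eq_zero fun v _ => if_neg (hG.adj_ne _ _ _ _ hc'.symm)
    · simp
  have hroot : ∀ c (v : W c), G.Adj (e (some ⟨c, v⟩)) (e none) ↔ v = rc c := by
    intro c v; rw [G.adj_comm, hG.root_adj]
  rw [hsum, hsum (fun v => spin (σ v))]
  simp only [hsum (fun v => if G.Adj _ v then _ else _), hloop, hG.root_adj, hroot, hdiag,
    Finset.sum_add_distrib, Finset.sum_ite_eq', Finset.mem_univ, if_true, if_false, zero_add,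
    Finset.mul_sum, mul_add]
  -- Each edge at the root occurs in both orders in the double sum; making the two terms equal lets
  -- them cancel the factor 1/2.
  have hcomm : ∀ c, spin (σ (e (some ⟨c, rc c⟩))) * spin (σ (e none))
    = spin (σ (e none)) * spin (σ (e (some ⟨c, rc c⟩))) := fun c => mul_comm _ _
  simp only [hcomm]
  simp only [← Finset.mul_sum]
  ring

/-- Configurations on a branching: a spin for the root and configurations on the branches. -/
def branchConfig (e : Option (Σ c, W c) ≃ V) : ℤˣ × (∀ c, W c → ℤˣ) ≃ (V → ℤˣ) where
  toFun p v := match e.symm v with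
    | none => p.1
    | some x => p.2 x.1 x.2
  invFun σ := (σ (e none), fun c v => σ (e (some ⟨c, v⟩)))
  left_inv p := by simp
  right_inv σ := by
    funext v
    obtain ⟨o, rfl⟩ := e.surjective v
    rcases o with _ | ⟨c, v⟩ <;> simp

/-- Once the root spin is fixed, weight and boundary condition are products over the branches, so
the sum of products is a product of sums. -/
lemma IsBranching.restrictedSum_eq {G : SimpleGraph V} {Gc : ∀ c, SimpleGraph (W c)}
    {rc : ∀ c, W c} {e : Option (Σ c, W c) ≃ V} (hG : IsBranching G Gc rc e) (β B : ℝ)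
    (b : V → Prop) (hb : ¬ b (e none)) (s : ℤˣ) :
    restrictedSum G (e none) b β B s = Real.exp (B * spin s) *
      ∏ c, (Real.exp (β * spin s) * restrictedSum (Gc c) (rc c) (fun v => b (e (some ⟨c, v⟩))) β B 1
        + Real.exp (-(β * spin s)) *
          restrictedSum (Gc c) (rc c) (fun v => b (e (some ⟨c, v⟩))) β B (-1)) := by
  classical
  have h0 : ∀ p : ℤˣ × (∀ c, W c → ℤˣ), branchConfig e p (e none) = p.1 := by
    intro p; simp [branchConfig]
  have h1 : ∀ (p : ℤˣ × (∀ c, W c → ℤˣ)) c v, branchConfig e p (e (some ⟨c, v⟩)) = p.2 c v := by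
    intro p c v; simp [branchConfig]
  have hbd : ∀ p : ℤˣ × (∀ c, W c → ℤˣ), (∀ v, b v → branchConfig e p v = 1) ↔
      ∀ c, ∀ v, b (e (some ⟨c, v⟩)) → p.2 c v = 1 := by
    intro p
    constructor
    · intro h c v hv
      rw [← h1]; exact h _ hv
    · intro h v hv
      obtain ⟨o, rfl⟩ := e.surjective v
      rcases o with _ | ⟨c, v⟩
      · exact absurd hv hb
      · rw [h1]; exact h c v hv
  have hbranch : ∀ c, Real.exp (β * spin s) *
        restrictedSum (Gc c) (rc c) (fun v => b (e (some ⟨c, v⟩))) β B 1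
        + Real.exp (-(β * spin s)) *
          restrictedSum (Gc c) (rc c) (fun v => b (e (some ⟨c, v⟩))) β B (-1)
      = ∑ σ : W c → ℤˣ, if ∀ v, b (e (some ⟨c, v⟩)) → σ v = 1 then
        Real.exp (β * (spin s * spin (σ (rc c)))) * isingWeight (Gc c) β B σ else 0 := by
    intro c
    rw [sum_boundary_eq (Gc c) (rc c) (fun v => b (e (some ⟨c, v⟩))) β B
      (fun a => Real.exp (β * (spin s * spin a)))]
    simp [spin]
  simp only [hbranch]
  rw [Finset.prod_univ_sum, restrictedSum, ← (branchConfig e).sum_comp, Fintype.sum_prod_type,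
    Fintype.piFinset_univ, Finset.sum_eq_single s, Finset.mul_sum]
  · refine Finset.sum_congr rfl fun f _ => ?_
    simp only [h0, hbd, hG.isingWeight_eq, h1, true_and]
    rw [Finset.prod_ite_zero]
    simp
  · intro a _ ha
    refine Finset.sum_eq_zero fun f _ => if_neg ?_
    simp [h0, ha]
  · exact fun h => absurd (Finset.mem_univ _) h

lemma IsBranching.boundaryMag_eq {G : SimpleGraph V} {Gc : ∀ c, SimpleGraph (W c)}
    {rc : ∀ c, W c} {e : Option (Σ c, W c) ≃ V} (hG : IsBranching G Gc rc e) (β B : ℝ)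
    (b : V → Prop) (hb : ¬ b (e none)) (m : C → ℝ)
    (hm : ∀ c, boundaryMag (Gc c) (rc c) (fun v => b (e (some ⟨c, v⟩))) β B = m c) :
    boundaryMag G (e none) b β B =
      (Real.exp B * ∏ c, (1 + m c * Real.tanh β) - Real.exp (-B) * ∏ c, (1 - m c * Real.tanh β)) /
      (Real.exp B * ∏ c, (1 + m c * Real.tanh β) + Real.exp (-B) * ∏ c, (1 - m c * Real.tanh β)) := by
  set Zp := fun c => restrictedSum (Gc c) (rc c) (fun v => b (e (some ⟨c, v⟩))) β B 1
  set Zm := fun c => restrictedSum (Gc c) (rc c) (fun v => b (e (some ⟨c, v⟩))) β B (-1)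
  have hpos : ∀ c, 0 < Zp c + Zm c := fun c =>
    add_pos_of_pos_of_nonneg (restrictedSum_one_pos ..) (restrictedSum_nonneg ..)
  have hm' : ∀ c, m c * (Zp c + Zm c) = Zp c - Zm c := by
    intro c
    rw [← hm c]
    exact div_mul_cancel₀ _ (hpos c).ne'
  have hcosh := Real.cosh_pos β
  have htanh : Real.tanh β * Real.cosh β = Real.sinh β := by
    rw [Real.tanh_eq_sinh_div_cosh]; field_simp
  -- Writing exp(±β) as cosh β ± sinh β extracts a factor that is the same for both root spins and
  -- cancels in the quotient.
  have hplus : ∀ c, Real.exp β * Zp c + Real.exp (-β) * Zm c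
      = (1 + m c * Real.tanh β) * (Real.cosh β * (Zp c + Zm c)) := by
    intro c
    rw [← Real.cosh_sub_sinh, ← Real.cosh_add_sinh]
    linear_combination (-(m c) * (Zp c + Zm c)) * htanh - Real.sinh β * hm' c
  have hminus : ∀ c, Real.exp (-β) * Zp c + Real.exp β * Zm c
      = (1 - m c * Real.tanh β) * (Real.cosh β * (Zp c + Zm c)) := by
    intro c
    rw [← Real.cosh_sub_sinh, ← Real.cosh_add_sinh]
    linear_combination (m c * (Zp c + Zm c)) * htanh + Real.sinh β * hm' c
  have hK : 0 < ∏ c, (Real.cosh β * (Zp c + Zm c)) :=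
    Finset.prod_pos fun c _ => mul_pos hcosh (hpos c)
  have e1 : restrictedSum G (e none) b β B 1 = Real.exp B * (∏ c, (1 + m c * Real.tanh β)) *
      ∏ c, (Real.cosh β * (Zp c + Zm c)) := by
    rw [hG.restrictedSum_eq β B b hb, mul_assoc, ← Finset.prod_mul_distrib]
    simp only [spin, Units.val_one, Int.cast_one, mul_one]
    exact congrArg _ (Finset.prod_congr rfl fun c _ => hplus c)
  have e2 : restrictedSum G (e none) b β B (-1) = Real.exp (-B) * (∏ c, (1 - m c * Real.tanh β)) *
      ∏ c, (Real.cosh β * (Zp c + Zm c)) := by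
    rw [hG.restrictedSum_eq β B b hb, mul_assoc, ← Finset.prod_mul_distrib]
    simp only [spin, Units.val_neg, Units.val_one, Int.cast_neg, Int.cast_one, mul_neg, mul_one,
      neg_neg]
    exact congrArg _ (Finset.prod_congr rfl fun c _ => hminus c)
  rw [boundaryMag, e1, e2, ← sub_mul, ← add_mul, mul_div_mul_right _ _ hK.ne']

end TreeIsing

/-! ### The recursion for the magnetisations of the truncated trees -/

/-- The offspring numbers in the subtree at the child `c` of the root. -/
def shift (c : Fin 3 × ℕ) (N : Offspring) : Offspring := fun p => N (c :: p.1, p.2)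

/-- The pair of root magnetisations, computed recursively from the subtrees at the children. -/
def mag (β B : ℝ) : ℕ → Offspring → Square
  | 0, _ => corner
  | ℓ + 1, N => bpMap β B (fun τ => N ([], τ), fun c => mag β B ℓ (shift c N))

/-- The word `w` is a vertex of the tree with offspring numbers `N`. -/
def IsVertex (N : Offspring) : Word → Prop
  | [] => True
  | c :: w => c.2 < N ([], c.1) ∧ IsVertex (shift c N) w

/-- The type of the vertex `w` if the root has type `σ`. -/
def typeFrom (σ : Fin 3) (w : Word) : Fin 3 := w.foldl (fun _ c => c.1) σ

lemma typeFrom_append (σ : Fin 3) (w : Word) (c : Fin 3 × ℕ) : typeFrom σ (w ++ [c]) = c.1 := by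
  simp [typeFrom]

lemma vertexType_append (w : Word) (c : Fin 3 × ℕ) : vertexType (w ++ [c]) = c.1 :=
  typeFrom_append 0 w c

lemma vertexType_mem_iff (h : Fin 2) {σ : Fin 3} (hσ : σ = 0 ∨ σ = h.succ) (w : Word) :
    (vertexType w = 0 ∨ vertexType w = h.succ) ↔ (typeFrom σ w = 0 ∨ typeFrom σ w = h.succ) := by
  rcases List.eq_nil_or_concat w with rfl | ⟨u, c, rfl⟩
  · simpa [vertexType, typeFrom] using hσ
  · rw [List.concat_eq_append, vertexType_append, typeFrom_append]

/-- Vertices of type `1` or `2` only have children of their own type. -/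
def TypeConsistent (σ : Fin 3) (N : Offspring) : Prop :=
  ∀ w τ, typeFrom σ w ≠ 0 → τ ≠ typeFrom σ w → N (w, τ) = 0

lemma TypeConsistent.shift {σ : Fin 3} {N : Offspring} (hN : TypeConsistent σ N)
    (c : Fin 3 × ℕ) : TypeConsistent c.1 (shift c N) :=
  fun w τ h1 h2 => hN (c :: w) τ h1 h2

lemma TypeConsistent.typeFrom_eq {σ : Fin 3} {N : Offspring} (hN : TypeConsistent σ N)
    (hσ : σ ≠ 0) {w : Word} (hw : IsVertex N w) : typeFrom σ w = σ := by
  induction w generalizing σ N with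
  | nil => rfl
  | cons c w ih =>
    have hc : c.1 = σ := by
      by_contra hne
      have := hN [] c.1 hσ hne
      have h1 := hw.1
      omega
    have := ih (hN.shift c) (hc ▸ hσ) hw.2
    rw [← hc]
    exact this

lemma isVertex_append (N : Offspring) (w : Word) (c : Fin 3 × ℕ) :
    IsVertex N (w ++ [c]) ↔ IsVertex N w ∧ c.2 < N (w, c.1) := by
  induction w generalizing N with
  | nil => simp [IsVertex]
  | cons a w ih =>
    simp only [List.cons_append, IsVertex, ih, and_assoc]
    rfl

lemma mem_level (N : Offspring) (k : ℕ) (w : Word) :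
    w ∈ level N k ↔ w.length = k ∧ IsVertex N w := by
  induction k generalizing w with
  | zero =>
    simp only [level, Finset.mem_singleton, List.length_eq_zero_iff]
    constructor
    · rintro rfl; exact ⟨rfl, trivial⟩
    · exact fun h => h.1
  | succ k ih =>
    simp only [level, Finset.mem_biUnion, Finset.mem_univ, true_and, Finset.mem_image,
      Finset.mem_range, ih]
    constructor
    · rintro ⟨u, ⟨hl, hu⟩, τ, i, hi, rfl⟩
      exact ⟨by simp [hl], (isVertex_append _ _ _).mpr ⟨hu, hi⟩⟩
    · rintro ⟨hl, hw⟩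
      rcases List.eq_nil_or_concat w with rfl | ⟨u, c, rfl⟩
      · simp at hl
      · rw [List.concat_eq_append] at hw hl ⊢
        rw [isVertex_append] at hw
        exact ⟨u, ⟨by simpa using hl, hw.1⟩, c.1, c.2, hw.2, rfl⟩

lemma mem_truncVertices (N : Offspring) (h : Fin 2) (ℓ : ℕ) (w : Word) :
    w ∈ truncVertices N h ℓ ↔
      w.length ≤ ℓ ∧ IsVertex N w ∧ (vertexType w = 0 ∨ vertexType w = h.succ) := by
  simp only [truncVertices, Finset.mem_filter, Finset.mem_biUnion, Finset.mem_range, mem_level]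
  constructor
  · rintro ⟨⟨k, hk, rfl, hw⟩, ht⟩
    exact ⟨by omega, hw, ht⟩
  · rintro ⟨hl, hw, ht⟩
    exact ⟨⟨_, by omega, rfl, hw⟩, ht⟩

/-- The truncation tests only the type of a vertex itself, not of its ancestors. Consistency closes
the gap: all descendants of a child of deleted type have the deleted type too. -/
lemma TypeConsistent.cons_mem_truncVertices {σ : Fin 3} {N : Offspring} (hN : TypeConsistent σ N)
    {h : Fin 2} (ℓ : ℕ) (c : Fin 3 × ℕ) (w : Word) :
    c :: w ∈ truncVertices N h (ℓ + 1) ↔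
      c.2 < N ([], c.1) ∧ (c.1 = 0 ∨ c.1 = h.succ) ∧ w ∈ truncVertices (CoupledIsing.shift c N) h ℓ := by
  simp only [mem_truncVertices, List.length_cons, add_le_add_iff_right, IsVertex]
  have ht : vertexType (c :: w) = typeFrom c.1 w := rfl
  rw [ht]
  constructor
  · rintro ⟨hl, ⟨hc, hw⟩, hty⟩
    have hc' : c.1 = 0 ∨ c.1 = h.succ := by
      by_cases h0 : c.1 = 0
      · exact Or.inl h0
      · rwa [(hN.shift c).typeFrom_eq h0 hw] at hty
    exact ⟨hc, hc', hl, hw, (vertexType_mem_iff h hc' w).mpr hty⟩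
  · rintro ⟨hc, hc', hl, hw, hty⟩
    exact ⟨hl, ⟨hc, hw⟩, (vertexType_mem_iff h hc' w).mp hty⟩

lemma TypeConsistent.mem_of_append_mem {σ : Fin 3} {N : Offspring} (hN : TypeConsistent σ N)
    {h : Fin 2} (hσ : σ = 0 ∨ σ = h.succ) {ℓ : ℕ} {w : Word} {c : Fin 3 × ℕ}
    (hw : w ++ [c] ∈ truncVertices N h ℓ) : w ∈ truncVertices N h ℓ := by
  rw [mem_truncVertices, isVertex_append, vertexType_append, List.length_append] at hw
  obtain ⟨hl, ⟨hw, hc⟩, ht⟩ := hw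
  rw [mem_truncVertices, vertexType_mem_iff h hσ]
  refine ⟨by omega, hw, ?_⟩
  by_contra hcon
  push Not at hcon
  -- A parent of deleted type would have a child of a different type, which consistency forbids.
  have := hN w c.1 hcon.1 (by
    rintro heq
    rw [heq] at ht
    exact ht.elim hcon.1 hcon.2)
  omega

lemma walk_length_le {T : Finset Word} {u v : T} (p : (wordGraph.comap (Subtype.val : T → Word)).Walk u v) :
    v.1.length ≤ u.1.length + p.length := by
  induction p with
  | nil => simp
  | cons hadj p ih =>
    rw [SimpleGraph.Walk.length_cons]
    rcases hadj with ⟨c, hc⟩ | ⟨c, hc⟩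
    · rw [hc] at ih
      simp only [List.length_append, List.length_singleton] at ih
      omega
    · rw [hc]
      simp only [List.length_append, List.length_singleton]
      omega

/-- Prefixes give a walk of the right length, and a step changes the word length by only one. Word
length, unlike distance, passes to the branches by subtracting one. -/
lemma edist_eq_length {T : Finset Word} (hnil : [] ∈ T)
    (hT : ∀ w c, w ++ [c] ∈ T → w ∈ T) (v : T) :
    (wordGraph.comap (Subtype.val : T → Word)).edist ⟨[], hnil⟩ v = v.1.length := by
  have hle : ∀ w (hw : w ∈ T), ∃ p : (wordGraph.comap (Subtype.val : T → Word)).Walk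
      ⟨[], hnil⟩ ⟨w, hw⟩, p.length = w.length := by
    intro w
    induction w using List.reverseRecOn with
    | nil => exact fun _ => ⟨.nil, rfl⟩
    | append_singleton u c ih =>
      intro hw
      obtain ⟨p, hp⟩ := ih (hT u c hw)
      have hadj : (wordGraph.comap (Subtype.val : T → Word)).Adj ⟨u, hT u c hw⟩ ⟨u ++ [c], hw⟩ :=
        Or.inl ⟨c, rfl⟩
      exact ⟨p.concat hadj, by simp [SimpleGraph.Walk.length_concat, hp]⟩
  obtain ⟨p, hp⟩ := hle v.1 v.2
  refine le_antisymm (hp ▸ SimpleGraph.edist_le p) ?_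
  obtain ⟨q, hq⟩ := SimpleGraph.Reachable.exists_walk_length_eq_edist ⟨p⟩
  rw [← hq]
  have := walk_length_le q
  simp only [List.length_nil, zero_add] at this
  exact_mod_cast this

lemma boundaryMag_of_root {V : Type*} [Fintype V] [DecidableEq V] (G : SimpleGraph V) (r : V)
    (b : V → Prop) (hr : b r) (β B : ℝ) : boundaryMag G r b β B = 1 := by
  have h0 : restrictedSum G r b β B (-1) = 0 := by
    refine Finset.sum_eq_zero fun σ _ => if_neg ?_
    rintro ⟨h1, h2⟩
    rw [h2 r hr] at h1
    exact absurd h1 (by decide)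
  rw [boundaryMag, h0, sub_zero, add_zero, div_self (restrictedSum_one_pos ..).ne']

/-- The letter of a child of the root that belongs to the subtree with index `h`. -/
def childLetter (h : Fin 2) {m n : ℕ} : Fin m ⊕ Fin n → Fin 3 × ℕ :=
  Sum.elim (fun i => (0, i)) (fun i => (h.succ, i))

lemma childLetter_injective (h : Fin 2) {m n : ℕ} :
    Function.Injective (childLetter h : Fin m ⊕ Fin n → Fin 3 × ℕ) := by
  rintro (i | i) (j | j) hij
  · simp only [childLetter, Sum.elim_inl, Prod.mk.injEq, true_and] at hij
    rw [Fin.ext hij]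
  · simp only [childLetter, Sum.elim_inl, Sum.elim_inr, Prod.mk.injEq] at hij
    exact absurd hij.1.symm (Fin.succ_ne_zero h)
  · simp only [childLetter, Sum.elim_inl, Sum.elim_inr, Prod.mk.injEq] at hij
    exact absurd hij.1 (Fin.succ_ne_zero h)
  · simp only [childLetter, Sum.elim_inr, Prod.mk.injEq, true_and] at hij
    rw [Fin.ext hij]

lemma childLetter_type (h : Fin 2) {m n : ℕ} (c : Fin m ⊕ Fin n) :
    (childLetter h c).1 = 0 ∨ (childLetter h c).1 = h.succ := by
  rcases c with i | i <;> simp [childLetter]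

lemma exists_childLetter {N : Offspring} {h : Fin 2} {c : Fin 3 × ℕ} (hc : c.2 < N ([], c.1))
    (ht : c.1 = 0 ∨ c.1 = h.succ) :
    ∃ a : Fin (N ([], 0)) ⊕ Fin (N ([], h.succ)), childLetter h a = c := by
  obtain ⟨τ, i⟩ := c
  rcases ht with rfl | rfl
  · exact ⟨Sum.inl ⟨i, hc⟩, rfl⟩
  · exact ⟨Sum.inr ⟨i, hc⟩, rfl⟩

lemma childLetter_lt {N : Offspring} {h : Fin 2} (a : Fin (N ([], 0)) ⊕ Fin (N ([], h.succ))) :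
    (childLetter h a).2 < N ([], (childLetter h a).1) := by
  rcases a with i | i <;> simp [childLetter]

/-- The root and the subtrees at the children of the root exhaust the vertices. -/
def branchEquiv {σ : Fin 3} {N : Offspring} (hN : TypeConsistent σ N) (h : Fin 2) (ℓ : ℕ) :
    Option (Σ a : Fin (N ([], 0)) ⊕ Fin (N ([], h.succ)),
      truncVertices (shift (childLetter h a) N) h ℓ) ≃ truncVertices N h (ℓ + 1) :=
  Equiv.ofBijective
    (fun o => match o with
      | none => truncRoot N h (ℓ + 1)
      | some x => ⟨childLetter h x.1 :: x.2.1, (hN.cons_mem_truncVertices ℓ _ _).mpr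
          ⟨childLetter_lt x.1, childLetter_type h x.1, x.2.2⟩⟩) (by
    constructor
    · rintro (_ | ⟨a, u, hu⟩) (_ | ⟨a', u', hu'⟩) hEq
      · rfl
      · simp [truncRoot] at hEq
      · simp [truncRoot] at hEq
      · simp only [Subtype.mk.injEq, List.cons.injEq] at hEq
        obtain ⟨h1, rfl⟩ := hEq
        obtain rfl := childLetter_injective h h1
        rfl
    · rintro ⟨_ | ⟨c, w⟩, hw⟩
      · exact ⟨none, rfl⟩
      · obtain ⟨hc, ht, hw'⟩ := (hN.cons_mem_truncVertices ℓ _ _).mp hw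
        obtain ⟨a, rfl⟩ := exists_childLetter hc ht
        exact ⟨some ⟨a, w, hw'⟩, rfl⟩)

lemma isBranching_truncTree {σ : Fin 3} {N : Offspring} (hN : TypeConsistent σ N) (h : Fin 2)
    (ℓ : ℕ) : IsBranching (truncTree N h (ℓ + 1))
      (fun a : Fin (N ([], 0)) ⊕ Fin (N ([], h.succ)) => truncTree (shift (childLetter h a) N) h ℓ)
      (fun _ => truncRoot _ h ℓ) (branchEquiv hN h ℓ) where
  root_adj a v := by
    change ((∃ c, childLetter h a :: v.1 = [] ++ [c]) ∨ ∃ c, [] = (childLetter h a :: v.1) ++ [c]) ↔ _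
    simp [Subtype.ext_iff, truncRoot]
  adj_same a u v := by
    change ((∃ c, childLetter h a :: v.1 = (childLetter h a :: u.1) ++ [c]) ∨
      ∃ c, childLetter h a :: u.1 = (childLetter h a :: v.1) ++ [c]) ↔
      ((∃ c, v.1 = u.1 ++ [c]) ∨ ∃ c, u.1 = v.1 ++ [c])
    simp
  adj_ne a a' u v hne := by
    change ¬ ((∃ c, childLetter h a' :: v.1 = (childLetter h a :: u.1) ++ [c]) ∨
      ∃ c, childLetter h a :: u.1 = (childLetter h a' :: v.1) ++ [c])
    have := (childLetter_injective (m := N ([], 0)) (n := N ([], h.succ)) h).ne hne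
    simp [this, this.symm]

/-- Induction on the depth through the branching at the root. The root type stays arbitrary because
the subtrees at the children may have any kept type. -/
lemma TypeConsistent.boundaryMag_eq_mag {σ : Fin 3} {N : Offspring} (hN : TypeConsistent σ N)
    {h : Fin 2} (β B : ℝ) (ℓ : ℕ) :
    boundaryMag (truncTree N h ℓ) (truncRoot N h ℓ) (fun v => v.1.length = ℓ) β B
      = mag β B ℓ N h := by
  induction ℓ generalizing σ N with
  | zero =>
    exact boundaryMag_of_root (truncTree N h 0) (truncRoot N h 0)
        (fun v => v.1.length = 0) rfl β B
  | succ ℓ ih =>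
    have key := (isBranching_truncTree hN h ℓ).boundaryMag_eq β B
      (fun v => v.1.length = ℓ + 1) (by simp [branchEquiv, truncRoot])
      (fun a => mag β B ℓ (CoupledIsing.shift (childLetter h a) N) h) (by
        intro a
        rw [← ih (hN.shift _)]
        have hval : ∀ v, (branchEquiv hN h ℓ (some ⟨a, v⟩)).1 = childLetter h a :: v.1 :=
          fun _ => rfl
        simp only [hval, List.length_cons, add_left_inj])
    have hroot : branchEquiv hN h ℓ none = truncRoot N h (ℓ + 1) := rfl
    rw [hroot] at key
    rw [key]
    simp only [mag, bpMap, bpRatio, bpWeight, Fintype.prod_sum_type, Finset.prod_range, childLetter,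
      Sum.elim_inl, Sum.elim_inr, one_mul, neg_mul, ← sub_eq_add_neg, mul_assoc]

lemma TypeConsistent.treeMagnetisation_eq {N : Offspring} (hN : TypeConsistent 0 N)
    (β B : ℝ) (ℓ : ℕ) :
    treeMagnetisation β B ℓ N = fun h => (mag β B ℓ N h : ℝ) := by
  funext h
  rw [treeMagnetisation, rootMagnetisation_eq_boundaryMag, ← hN.boundaryMag_eq_mag β B ℓ]
  congr 1
  funext v
  rw [show (truncTree N h ℓ).edist (truncRoot N h ℓ) v = v.1.length from
    edist_eq_length _ (fun w c hw => hN.mem_of_append_mem (Or.inl rfl) hw) v]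
  simp

/-! ### Splitting infinite product measures -/

section ProductMeasures

lemma infinitePi_prod_map_sumElim {ι κ X : Type*} [MeasurableSpace X] (μ : ι ⊕ κ → Measure X)
    [∀ i, IsProbabilityMeasure (μ i)] :
    ((Measure.infinitePi fun i => μ (Sum.inl i)).prod
      (Measure.infinitePi fun k => μ (Sum.inr k))).map
        (fun p : (ι → X) × (κ → X) => (Sum.elim p.1 p.2 : ι ⊕ κ → X)) = Measure.infinitePi μ := by
  have hmeas : Measurable (fun p : (ι → X) × (κ → X) => (Sum.elim p.1 p.2 : ι ⊕ κ → X)) := by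
    refine measurable_pi_lambda _ ?_
    rintro (i | k)
    · exact (measurable_pi_apply i).comp measurable_fst
    · exact (measurable_pi_apply k).comp measurable_snd
  refine Measure.eq_infinitePi μ fun s t ht => ?_
  have hpre : (fun p : (ι → X) × (κ → X) => (Sum.elim p.1 p.2 : ι ⊕ κ → X)) ⁻¹' Set.pi s t
      = (Set.pi s.toLeft fun i => t (Sum.inl i)) ×ˢ (Set.pi s.toRight fun k => t (Sum.inr k)) := by
    ext p
    simp [Set.mem_pi]
  rw [Measure.map_apply hmeas (MeasurableSet.pi s.countable_toSet fun i _ => ht i), hpre,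
    Measure.prod_prod, Measure.infinitePi_pi _ (fun i _ => ht _),
    Measure.infinitePi_pi _ (fun i _ => ht _)]
  conv_rhs => rw [← Finset.toLeft_disjSum_toRight (u := s), Finset.prod_disjSum]

lemma infinitePi_map_sum {ι κ X : Type*} [MeasurableSpace X] (μ : ι ⊕ κ → Measure X)
    [∀ i, IsProbabilityMeasure (μ i)] :
    (Measure.infinitePi μ).map (fun x => (fun i => x (Sum.inl i), fun k => x (Sum.inr k)))
      = (Measure.infinitePi fun i => μ (Sum.inl i)).prod
        (Measure.infinitePi fun k => μ (Sum.inr k)) := by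
  rw [← infinitePi_prod_map_sumElim, Measure.map_map (by fun_prop)]
  · exact Measure.map_id
  · refine measurable_pi_lambda _ ?_
    rintro (i | k)
    · exact (measurable_pi_apply i).comp measurable_fst
    · exact (measurable_pi_apply k).comp measurable_snd

end ProductMeasures

/-! ### The laws of the random tree and of its magnetisations -/

/-- Law of the offspring numbers of a tree whose root has type `σ`. -/
def gwFrom (d : ℝ) (t : unitInterval) (σ : Fin 3) : Measure Offspring :=
  Measure.infinitePi fun p : Word × Fin 3 => poissonMeasure (offspringRate d t (typeFrom σ p.1) p.2)

instance (d : ℝ) (t : unitInterval) (σ : Fin 3) : IsProbabilityMeasure (gwFrom d t σ) := by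
  unfold gwFrom; infer_instance

lemma measurable_shift (c : Fin 3 × ℕ) : Measurable (shift c) :=
  measurable_pi_lambda _ fun _ => measurable_pi_apply _

/-- The offspring numbers of the root are independent of the independent subtrees at its
children. -/
lemma gwFrom_map_branches (d : ℝ) (t : unitInterval) (σ : Fin 3) :
    (gwFrom d t σ).map (fun N => (fun τ => N ([], τ), fun c => shift c N))
      = (Measure.pi fun τ => poissonMeasure (offspringRate d t σ τ)).prod
        (Measure.infinitePi fun c : Fin 3 × ℕ => gwFrom d t c.1) := by
  -- The index set splits into the root's own numbers and, by first letter, those of the subtrees;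
  -- `h3` then curries the second part.
  let e : Fin 3 ⊕ ((Fin 3 × ℕ) × (Word × Fin 3)) → Word × Fin 3 :=
    Sum.elim (fun τ => ([], τ)) (fun q => (q.1 :: q.2.1, q.2.2))
  have he : Function.Injective e := by
    rintro (τ | ⟨c, w, τ⟩) (τ' | ⟨c', w', τ'⟩) h <;> simp_all [e]
  let ν : Fin 3 ⊕ ((Fin 3 × ℕ) × (Word × Fin 3)) → Measure ℕ := fun i =>
    poissonMeasure (offspringRate d t (typeFrom σ (e i).1) (e i).2)
  have hν : ∀ i, IsProbabilityMeasure (ν i) := fun i => by dsimp only [ν]; infer_instance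
  have h1 := Measure.map_infinitePi_infinitePi_of_inj
    (P := fun p : Word × Fin 3 => poissonMeasure (offspringRate d t (typeFrom σ p.1) p.2)) he
  have h2 := infinitePi_map_sum ν
  have h3 := Measure.infinitePi_map_curry (fun (c : Fin 3 × ℕ) (p : Word × Fin 3) =>
    poissonMeasure (offspringRate d t (typeFrom c.1 p.1) p.2))
  have h4 : (Measure.infinitePi fun k => ν (Sum.inr k)) = Measure.infinitePi
    fun p : (Fin 3 × ℕ) × (Word × Fin 3) =>
      poissonMeasure (offspringRate d t (typeFrom p.1.1 p.2.1) p.2.2) := rfl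
  have h5 : (Measure.infinitePi fun k => ν (Sum.inl k)) =
      Measure.pi fun τ => poissonMeasure (offspringRate d t σ τ) :=
    Measure.infinitePi_eq_pi _
  rw [h4, h5] at h2
  have h6 : (Measure.infinitePi ν) = (gwFrom d t σ).map (fun N i => N (e i)) := h1.symm
  rw [h6, Measure.map_map (by fun_prop) (by fun_prop)] at h2
  have hc : Measurable (MeasurableEquiv.curry (Fin 3 × ℕ) (Word × Fin 3) ℕ) :=
    MeasurableEquiv.measurable _
  have h7 := congrArg (Measure.map (Prod.map id (MeasurableEquiv.curry (Fin 3 × ℕ) (Word × Fin 3) ℕ)))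
    h2
  rw [← Measure.map_prod_map _ _ measurable_id hc, h3, Measure.map_id,
    Measure.map_map (measurable_id.prodMap hc) (by fun_prop)] at h7
  exact h7

lemma measurable_mag (β B : ℝ) (ℓ : ℕ) : Measurable (mag β B ℓ) := by
  induction ℓ with
  | zero => exact measurable_const
  | succ ℓ ih =>
    exact (measurable_bpMap β B).comp (Measurable.prodMk (by fun_prop)
      (measurable_pi_lambda _ fun c => ih.comp (measurable_shift c)))

/-- Law of the pair of magnetisations on a tree whose root has type `σ`. -/
def magLaw (d β B : ℝ) (t : unitInterval) (ℓ : ℕ) (σ : Fin 3) : Measure Square :=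
  (gwFrom d t σ).map (mag β B ℓ)

instance (d β B : ℝ) (t : unitInterval) (ℓ : ℕ) (σ : Fin 3) :
    IsProbabilityMeasure (magLaw d β B t ℓ σ) :=
  Measure.isProbabilityMeasure_map (measurable_mag β B ℓ).aemeasurable

lemma magLaw_zero (d β B : ℝ) (t : unitInterval) (σ : Fin 3) :
    magLaw d β B t 0 σ = Measure.dirac corner := by
  have : mag β B 0 = fun _ => corner := rfl
  rw [magLaw, this, Measure.map_const, measure_univ, one_smul]

/-- The branch independence of `gwFrom_map_branches`, pushed through one step of `mag`. -/
lemma magLaw_succ (d β B : ℝ) (t : unitInterval) (ℓ : ℕ) (σ : Fin 3) :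
    magLaw d β B t (ℓ + 1) σ =
      ((Measure.pi fun τ => poissonMeasure (offspringRate d t σ τ)).prod
        (Measure.infinitePi fun c : Fin 3 × ℕ => magLaw d β B t ℓ c.1)).map (bpMap β B) := by
  have hm : Measurable fun (x : Fin 3 × ℕ → Offspring) c => mag β B ℓ (x c) :=
    measurable_pi_lambda _ fun c => (measurable_mag β B ℓ).comp (measurable_pi_apply c)
  have h1 := Measure.infinitePi_map_pi (fun c : Fin 3 × ℕ => gwFrom d t c.1)
    (f := fun _ => mag β B ℓ) (fun _ => measurable_mag β B ℓ)
  have h2 : (Measure.infinitePi fun c : Fin 3 × ℕ => magLaw d β B t ℓ c.1) =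
    (Measure.infinitePi fun c : Fin 3 × ℕ => gwFrom d t c.1).map fun x c => mag β B ℓ (x c) :=
    h1.symm
  conv_rhs => rw [h2, ← Measure.map_id (μ := Measure.pi _),
    Measure.map_prod_map _ _ measurable_id hm, ← gwFrom_map_branches]
  rw [Measure.map_map (measurable_id.prodMap hm), Measure.map_map (measurable_bpMap β B)]
  · rfl
  · exact ((measurable_id.prodMap hm).comp (Measurable.prodMk (by fun_prop)
      (measurable_pi_lambda _ measurable_shift)))
  · exact Measurable.prodMk (by fun_prop) (measurable_pi_lambda _ measurable_shift)

lemma ae_poissonMeasure_zero : ∀ᵐ k ∂(poissonMeasure 0), k = 0 := by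
  rw [ae_iff]
  have : {k : ℕ | ¬ k = 0} = {0}ᶜ := rfl
  rw [this, prob_compl_eq_zero_iff (measurableSet_singleton 0), poissonMeasure_singleton]
  simp

lemma offspringRate_eq_zero (d : ℝ) (t : unitInterval) {σ τ : Fin 3} (hσ : σ ≠ 0) (hτ : τ ≠ σ) :
    offspringRate d t σ τ = 0 := by
  fin_cases σ <;> fin_cases τ <;> simp_all [offspringRate]

/-- The forbidden offspring numbers are countably many Poisson variables of mean zero. -/
lemma ae_typeConsistent (d : ℝ) (t : unitInterval) :
    ∀ᵐ N ∂(gwMeasure d t), TypeConsistent 0 N := by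
  unfold TypeConsistent
  rw [ae_all_iff]
  intro w
  rw [ae_all_iff]
  intro τ
  by_cases hw : typeFrom 0 w ≠ 0 ∧ τ ≠ typeFrom 0 w
  · have hmp := measurePreserving_eval_infinitePi
      (fun p : Word × Fin 3 => poissonMeasure (offspringRate d t (vertexType p.1) p.2)) (w, τ)
    have h0 : offspringRate d t (vertexType w) τ = 0 := offspringRate_eq_zero d t hw.1 hw.2
    have := ae_poissonMeasure_zero
    rw [← h0] at this
    filter_upwards [hmp.quasiMeasurePreserving.ae this] with N hN _ _
    exact hN
  · exact Eventually.of_forall fun N h1 h2 => absurd ⟨h1, h2⟩ hw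

/-! ### Single coordinates and the coupled iterates -/

lemma offspringRate_add {d : ℝ} (hd : 0 < d) (t : unitInterval) {h : Fin 2} {σ : Fin 3}
    (hσ : σ = 0 ∨ σ = h.succ) :
    offspringRate d t σ 0 + offspringRate d t σ h.succ = d.toNNReal := by
  have h1 : 0 ≤ d * (t : ℝ) := mul_nonneg hd.le t.2.1
  have h2 : 0 ≤ d * (1 - (t : ℝ)) := mul_nonneg hd.le (sub_nonneg.mpr t.2.2)
  have h3 : d * (t : ℝ) + d * (1 - (t : ℝ)) = d := by ring
  rcases hσ with rfl | rfl <;> fin_cases h <;>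
    simp [offspringRate, ← Real.toNNReal_add h1 h2, h3]

lemma pi_poissonMeasure_map_add (r : Fin 3 → ℝ≥0) (h : Fin 2) :
    (Measure.pi fun τ => poissonMeasure (r τ)).map (fun n => n 0 + n h.succ)
      = poissonMeasure (r 0 + r h.succ) := by
  rw [← poissonMeasure_conv_poissonMeasure, Measure.conv,
    ← Measure.infinitePi_map_eval_prod (P := fun τ => poissonMeasure (r τ))
      (Fin.succ_ne_zero h).symm, Measure.infinitePi_eq_pi,
    Measure.map_map (by fun_prop) (by fun_prop)]
  rfl

/-- The update of a single magnetisation with `n` children of magnetisations `y 0, y 1, …`. -/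
def plainMap (β B : ℝ) (p : ℕ × (ℕ → Set.Icc (-1 : ℝ) 1)) : Set.Icc (-1 : ℝ) 1 :=
  bpMap β B (fun τ => if τ = 0 then 0 else p.1, fun c _ => p.2 c.2) 0

lemma measurable_plainMap (β B : ℝ) : Measurable (plainMap β B) := by
  refine (measurable_pi_apply (0 : Fin 2)).comp ((measurable_bpMap β B).comp
    (Measurable.prodMk (measurable_pi_lambda _ fun τ => ?_) (by fun_prop)))
  split_ifs <;> fun_prop

/-- The uncoupled Belief Propagation operator with offspring law `Po(r)`. -/
def plainBP (r : ℝ≥0) (β B : ℝ) (ν : Measure (Set.Icc (-1 : ℝ) 1)) :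
    Measure (Set.Icc (-1 : ℝ) 1) :=
  ((poissonMeasure r).prod (Measure.infinitePi fun _ : ℕ => ν)).map (plainMap β B)

/-- Enumeration of the `m` children of type `0`, followed by the children of type `h.succ`. -/
def enumChildren (h : Fin 2) (m k : ℕ) : Fin 3 × ℕ :=
  if k < m then (0, k) else (h.succ, k - m)

lemma enumChildren_injective (h : Fin 2) (m : ℕ) : Function.Injective (enumChildren h m) := by
  intro k k' hk
  have h0 := Fin.succ_ne_zero h
  unfold enumChildren at hk
  split_ifs at hk <;> simp only [Prod.mk.injEq, true_and, h0, h0.symm, false_and] at hk <;> omega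

lemma bpMap_eq_plainMap (β B : ℝ) (n : Fin 3 → ℕ) (x : Fin 3 × ℕ → Square) (h : Fin 2) :
    bpMap β B (n, x) h = plainMap β B (n 0 + n h.succ, fun k => x (enumChildren h (n 0) k) h) := by
  have hw : ∀ s, bpWeight β B (n, x) h s = bpWeight β B
      (fun τ => if τ = 0 then 0 else n 0 + n h.succ,
        fun c _ => x (enumChildren h (n 0) c.2) h) 0 s := by
    intro s
    simp only [bpWeight, Fin.succ_ne_zero, if_true, if_false, Finset.range_zero,
      Finset.prod_empty, mul_one, Finset.prod_range_add, mul_assoc]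
    congr 2
    · refine Finset.prod_congr rfl fun i hi => ?_
      simp [enumChildren, Finset.mem_range.mp hi]
    · refine Finset.prod_congr rfl fun i hi => ?_
      simp [enumChildren]
  apply Subtype.ext
  simp only [plainMap, bpMap, bpRatio, hw]

/-- The law of one coordinate of the pair of magnetisations does not depend on `t`. -/
lemma magLaw_map_eval {d : ℝ} (hd : 0 < d) (β B : ℝ) (t : unitInterval) (h : Fin 2) (ℓ : ℕ)
    {σ : Fin 3} (hσ : σ = 0 ∨ σ = h.succ) :
    (magLaw d β B t ℓ σ).map (fun x => x h)
      = (plainBP d.toNNReal β B)^[ℓ] (Measure.dirac (corner h)) := by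
  induction ℓ generalizing σ with
  | zero =>
    rw [magLaw_zero]
    exact Measure.map_dirac' (f := fun x : Square => x h) (measurable_pi_apply h) corner
  | succ ℓ ih =>
    set ν := (plainBP d.toNNReal β B)^[ℓ] (Measure.dirac (corner h)) with hνdef
    have hν : IsProbabilityMeasure ν := by
      rw [← ih (Or.inl rfl)]
      exact Measure.isProbabilityMeasure_map (measurable_pi_apply h).aemeasurable
    set P := Measure.infinitePi fun c : Fin 3 × ℕ => magLaw d β B t ℓ c.1 with hP
    -- The enumeration meets only children of types 0 and `h.succ`, whose coordinate `h` has law `ν`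
    -- by induction; injectivity preserves independence.
    have hreindex : ∀ m, P.map (fun x k => x (enumChildren h m k) h)
        = Measure.infinitePi fun _ : ℕ => ν := by
      intro m
      have h1 := Measure.map_infinitePi_infinitePi_of_inj
        (P := fun c : Fin 3 × ℕ => magLaw d β B t ℓ c.1) (enumChildren_injective h m)
      have h2 := Measure.infinitePi_map_pi
        (fun k => magLaw d β B t ℓ (enumChildren h m k).1)
        (f := fun _ x => x h) (fun _ => measurable_pi_apply h)
      rw [← h1, Measure.map_map (by fun_prop) (by fun_prop)] at h2
      have h3 : ∀ k, (magLaw d β B t ℓ (enumChildren h m k).1).map (fun x => x h) = ν := by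
        intro k
        refine ih ?_
        unfold enumChildren
        split_ifs <;> simp
      simp only [h3] at h2
      exact h2
    rw [Function.iterate_succ_apply', ← hνdef, plainBP, magLaw_succ, ← hP,
      Measure.map_map (by fun_prop) (measurable_bpMap β B)]
    ext s hs
    have hF : Measurable fun m : ℕ =>
        (Measure.infinitePi fun _ : ℕ => ν) {y | plainMap β B (m, y) ∈ s} := measurable_from_top
    have hb : Measurable ((fun x : Square => x h) ∘ bpMap β B) :=
      (measurable_pi_apply h).comp (measurable_bpMap β B)
    rw [Measure.map_apply hb hs, Measure.map_apply (measurable_plainMap β B) hs,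
      Measure.prod_apply (hb hs), Measure.prod_apply (measurable_plainMap β B hs),
      ← offspringRate_add hd t hσ, ← pi_poissonMeasure_map_add (offspringRate d t σ) h]
    -- Given `n`, the reindexed children are i.i.d. with law `ν` whatever `n 0` is, so the inner
    -- probability depends on `n` only through the sum `n 0 + n h.succ`.
    refine Eq.trans (lintegral_congr fun n => ?_) (lintegral_map hF (by fun_prop)).symm
    have hset : MeasurableSet {y | plainMap β B (n 0 + n h.succ, y) ∈ s} :=
      (measurable_plainMap β B).comp measurable_prodMk_left hs
    rw [← hreindex (n 0), Measure.map_apply (by fun_prop) hset]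
    congr 1
    ext x
    simp only [Set.mem_preimage, Function.comp_apply, bpMap_eq_plainMap, Set.mem_ofPred_eq]

/-- The coordinates of a child of type `τ` that enter the coupled operator. -/
def usedCoordinates (τ : Fin 3) (x : Square) : Square :=
  Fin.cases (motive := fun _ => Square) x (fun h _ => x h) τ

lemma measurable_usedCoordinates (τ : Fin 3) : Measurable (usedCoordinates τ) := by
  cases τ using Fin.cases with
  | zero => exact measurable_id
  | succ h => exact measurable_pi_lambda _ fun _ => measurable_pi_apply h

lemma magLaw_map_usedCoordinates {d : ℝ} (hd : 0 < d) (β B : ℝ) (t : unitInterval) (ℓ : ℕ)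
    (τ : Fin 3) :
    (magLaw d β B t ℓ τ).map (usedCoordinates τ) = (magLaw d β B t ℓ 0).map (usedCoordinates τ) := by
  cases τ using Fin.cases with
  | zero => rfl
  | succ h =>
    have hcomp : usedCoordinates h.succ =
      (fun (y : Set.Icc (-1 : ℝ) 1) (_ : Fin 2) => y) ∘ (fun x : Square => x h) := rfl
    rw [hcomp, ← Measure.map_map (by fun_prop) (by fun_prop),
      ← Measure.map_map (by fun_prop) (by fun_prop),
      magLaw_map_eval hd β B t h ℓ (Or.inr rfl), magLaw_map_eval hd β B t h ℓ (Or.inl rfl)]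

/-- `bpMap` never reads the coordinates that `usedCoordinates` overwrites, so only the laws of the
used ones matter. -/
lemma map_bpMap_infinitePi (β B : ℝ) (μ : Measure (Fin 3 → ℕ)) [SFinite μ]
    (ρ : Fin 3 × ℕ → Measure Square) [∀ c, IsProbabilityMeasure (ρ c)] :
    (μ.prod (Measure.infinitePi ρ)).map (bpMap β B) =
      (μ.prod (Measure.infinitePi fun c => (ρ c).map (usedCoordinates c.1))).map (bpMap β B) := by
  have hm : Measurable fun (x : Fin 3 × ℕ → Square) c => usedCoordinates c.1 (x c) :=
    measurable_pi_lambda _ fun c => (measurable_usedCoordinates c.1).comp (measurable_pi_apply c)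
  rw [← Measure.infinitePi_map_pi ρ (f := fun c => usedCoordinates c.1)
    (fun c => measurable_usedCoordinates c.1)]
  conv_rhs => rw [← Measure.map_id (μ := μ), Measure.map_prod_map _ _ measurable_id hm,
    Measure.map_map (measurable_bpMap β B) (measurable_id.prodMap hm)]
  rfl

/-- The iterates of the coupled operator are the laws of the pairs of magnetisations. -/
lemma magLaw_eq_bpIterate {d : ℝ} (hd : 0 < d) (β B : ℝ) (t : unitInterval) (ℓ : ℕ) :
    magLaw d β B t ℓ 0 = bpIterate d β B t ℓ := by
  induction ℓ with
  | zero => rw [magLaw_zero]; rfl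
  | succ ℓ ih =>
    rw [bpIterate, Function.iterate_succ_apply', magLaw_succ]
    change _ = Measure.map (bpMap β B) (bpInput d t (bpIterate d β B t ℓ))
    rw [bpInput, ← ih, map_bpMap_infinitePi, map_bpMap_infinitePi (ρ := fun _ => magLaw d β B t ℓ 0)]
    simp only [magLaw_map_usedCoordinates hd]

/-! ### Monotonicity in the depth and the pointwise limit -/

section Monotonicity

/-- Since tanh β is nonnegative, raising the inputs raises every factor of the plus weight and
lowers every factor of the minus weight. -/
lemma bpMap_mono {β : ℝ} (hβ : 0 ≤ β) (B : ℝ) (n : Fin 3 → ℕ) {x y : Fin 3 × ℕ → Square}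
    (hxy : ∀ c, x c ≤ y c) : bpMap β B (n, x) ≤ bpMap β B (n, y) := by
  intro h
  have hx1 := bpWeight_pos β B (n, x) h (s := 1) (by simp)
  have hx2 := bpWeight_pos β B (n, x) h (s := -1) (by simp)
  have hy1 := bpWeight_pos β B (n, y) h (s := 1) (by simp)
  have hy2 := bpWeight_pos β B (n, y) h (s := -1) (by simp)
  have ht : 0 ≤ Real.tanh β := by
    rw [Real.tanh_eq_sinh_div_cosh]
    exact div_nonneg (Real.sinh_nonneg_iff.mpr hβ) (Real.cosh_pos β).le
  have hpos : ∀ (z : Fin 3 × ℕ → Square) c (s : ℝ), |s| = 1 →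
      0 ≤ 1 + s * (z c h : ℝ) * Real.tanh β := fun z c s hs => (bpFactor_pos β _ hs).le
  have hle : ∀ c, (x c h : ℝ) * Real.tanh β ≤ (y c h : ℝ) * Real.tanh β := fun c =>
    mul_le_mul_of_nonneg_right (hxy c h) ht
  have h1 : bpWeight β B (n, x) h 1 ≤ bpWeight β B (n, y) h 1 := by
    unfold bpWeight
    have hprod : ∀ τ, ∏ i ∈ Finset.range (n τ), (1 + 1 * (x (τ, i) h : ℝ) * Real.tanh β) ≤
        ∏ i ∈ Finset.range (n τ), (1 + 1 * (y (τ, i) h : ℝ) * Real.tanh β) := fun τ =>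
      Finset.prod_le_prod (fun i _ => hpos x _ 1 (by simp)) fun i _ => by
        have := hle (τ, i); linarith
    exact mul_le_mul (mul_le_mul_of_nonneg_left (hprod 0) (Real.exp_pos _).le) (hprod h.succ)
      (Finset.prod_nonneg fun i _ => hpos x _ 1 (by simp))
      (mul_nonneg (Real.exp_pos _).le (Finset.prod_nonneg fun i _ => hpos y _ 1 (by simp)))
  have h2 : bpWeight β B (n, y) h (-1) ≤ bpWeight β B (n, x) h (-1) := by
    unfold bpWeight
    have hprod : ∀ τ, ∏ i ∈ Finset.range (n τ), (1 + -1 * (y (τ, i) h : ℝ) * Real.tanh β) ≤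
        ∏ i ∈ Finset.range (n τ), (1 + -1 * (x (τ, i) h : ℝ) * Real.tanh β) := fun τ =>
      Finset.prod_le_prod (fun i _ => hpos y _ (-1) (by simp)) fun i _ => by
        have := hle (τ, i); linarith
    exact mul_le_mul (mul_le_mul_of_nonneg_left (hprod 0) (Real.exp_pos _).le) (hprod h.succ)
      (Finset.prod_nonneg fun i _ => hpos y _ (-1) (by simp))
      (mul_nonneg (Real.exp_pos _).le (Finset.prod_nonneg fun i _ => hpos x _ (-1) (by simp)))
  change bpRatio β B (n, x) h ≤ bpRatio β B (n, y) h
  unfold bpRatio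
  rw [div_le_div_iff₀ (add_pos hx1 hx2) (add_pos hy1 hy2)]
  -- After cross-multiplication only this comparison of the mixed plus-minus products remains.
  have := mul_le_mul h1 h2 hy2.le hy1.le
  nlinarith

lemma le_corner (x : Square) : x ≤ corner := fun h => (x h).2.2

lemma mag_succ_le {β : ℝ} (hβ : 0 ≤ β) (B : ℝ) (ℓ : ℕ) (N : Offspring) :
    mag β B (ℓ + 1) N ≤ mag β B ℓ N := by
  induction ℓ generalizing N with
  | zero => exact le_corner _
  | succ ℓ ih => exact bpMap_mono hβ B _ fun c => ih _

lemma mag_antitone {β : ℝ} (hβ : 0 ≤ β) (B : ℝ) (N : Offspring) :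
    Antitone fun ℓ => mag β B ℓ N :=
  antitone_nat_of_succ_le fun ℓ => mag_succ_le hβ B ℓ N

/-- The limit of the pairs of magnetisations as the depth tends to infinity. -/
def magLim (β B : ℝ) (N : Offspring) : Square := fun h =>
  ⟨⨅ ℓ, (mag β B ℓ N h : ℝ), le_ciInf fun ℓ => (mag β B ℓ N h).2.1,
    (ciInf_le ⟨-1, by rintro _ ⟨ℓ, rfl⟩; exact (mag β B ℓ N h).2.1⟩ 0).trans (mag β B 0 N h).2.2⟩

lemma magLim_le_mag (β B : ℝ) (ℓ : ℕ) (N : Offspring) : magLim β B N ≤ mag β B ℓ N := fun h =>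
  ciInf_le (f := fun ℓ => (mag β B ℓ N h : ℝ))
    ⟨-1, by rintro _ ⟨ℓ, rfl⟩; exact (mag β B ℓ N h).2.1⟩ ℓ

lemma tendsto_mag {β : ℝ} (hβ : 0 ≤ β) (B : ℝ) (N : Offspring) :
    Tendsto (fun ℓ => mag β B ℓ N) atTop (𝓝 (magLim β B N)) := by
  rw [tendsto_pi_nhds]
  intro h
  rw [tendsto_subtype_rng]
  exact tendsto_atTop_ciInf (fun i j hij => mag_antitone hβ B N hij h)
    ⟨-1, by rintro _ ⟨ℓ, rfl⟩; exact (mag β B ℓ N h).2.1⟩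

lemma measurable_magLim {β : ℝ} (hβ : 0 ≤ β) (B : ℝ) : Measurable (magLim β B) :=
  measurable_of_tendsto_metrizable (measurable_mag β B)
    (tendsto_pi_nhds.mpr fun N => tendsto_mag hβ B N)

end Monotonicity

/-! ### Wasserstein bounds from explicit couplings -/

section Wasserstein

/-- The `ℓ¹`-distance on the square. -/
def sqDist (x y : Square) : ℝ := ∑ h, |(x h : ℝ) - (y h : ℝ)|

lemma sqDist_nonneg (x y : Square) : 0 ≤ sqDist x y := Finset.sum_nonneg fun _ _ => abs_nonneg _

lemma sqDist_triangle (x y z : Square) : sqDist x z ≤ sqDist x y + sqDist y z := by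
  unfold sqDist
  rw [← Finset.sum_add_distrib]
  exact Finset.sum_le_sum fun h _ => abs_sub_le _ _ _

lemma sqDist_comm (x y : Square) : sqDist x y = sqDist y x :=
  Finset.sum_congr rfl fun _ _ => abs_sub_comm _ _

lemma sqDist_le (x y : Square) : sqDist x y ≤ 4 := by
  have : ∀ h, |(x h : ℝ) - (y h : ℝ)| ≤ 2 := fun h => by
    have h1 := (x h).2; have h2 := (y h).2
    rw [abs_le]
    constructor <;> linarith [h1.1, h1.2, h2.1, h2.2]
  calc sqDist x y ≤ ∑ _h : Fin 2, (2 : ℝ) := Finset.sum_le_sum fun h _ => this h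
    _ = 4 := by norm_num

lemma continuous_sqDist : Continuous fun p : Square × Square => sqDist p.1 p.2 := by
  unfold sqDist
  fun_prop

lemma measurable_sqDist {Ω : Type*} [MeasurableSpace Ω] {X Y : Ω → Square} (hX : Measurable X)
    (hY : Measurable Y) : Measurable fun ω => sqDist (X ω) (Y ω) := by
  unfold sqDist
  fun_prop

lemma integrable_sqDist {Ω : Type*} [MeasurableSpace Ω] {P : Measure Ω} [IsProbabilityMeasure P]
    {X Y : Ω → Square} (hX : Measurable X) (hY : Measurable Y) :
    Integrable (fun ω => sqDist (X ω) (Y ω)) P :=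
  Integrable.of_bound (measurable_sqDist hX hY).aestronglyMeasurable 4
    (Eventually.of_forall fun ω => by
      rw [Real.norm_of_nonneg (sqDist_nonneg _ _)]; exact sqDist_le _ _)

lemma wasserstein1_le {Ω : Type*} [MeasurableSpace Ω] {P : Measure Ω} [IsProbabilityMeasure P]
    {X Y : Ω → Square} (hX : Measurable X) (hY : Measurable Y) {μ ν : ProbabilityMeasure Square}
    (hμ : (μ : Measure Square) = P.map X) (hν : (ν : Measure Square) = P.map Y) :
    wasserstein1 μ ν ≤ ENNReal.ofReal (∫ ω, sqDist (X ω) (Y ω) ∂P) := by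
  rw [ofReal_integral_eq_lintegral_ofReal (integrable_sqDist hX hY)
    (Eventually.of_forall fun ω => sqDist_nonneg _ _)]
  refine (iInf_le _ (P.map fun ω => (X ω, Y ω))).trans ?_
  refine (iInf_le _ ?_).trans ((iInf_le _ ?_).trans ?_)
  · rw [Measure.fst_map_prodMk hY, hμ]
  · rw [Measure.snd_map_prodMk hX, hν]
  · have hm : Measurable fun p : Square × Square =>
        ENNReal.ofReal (∑ h, |(p.1 h : ℝ) - (p.2 h : ℝ)|) := by fun_prop
    rw [lintegral_map hm (hX.prodMk hY)]
    rfl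

lemma tendsto_integral_sqDist {Ω ι : Type*} [MeasurableSpace Ω] {P : Measure Ω}
    [IsProbabilityMeasure P] {l : Filter ι} [l.IsCountablyGenerated] {X : ι → Ω → Square}
    {Y : Ω → Square} (hX : ∀ i, Measurable (X i)) (hY : Measurable Y)
    (hlim : ∀ᵐ ω ∂P, Tendsto (fun i => X i ω) l (𝓝 (Y ω))) :
    Tendsto (fun i => ∫ ω, sqDist (X i ω) (Y ω) ∂P) l (𝓝 0) := by
  have : Tendsto (fun i => ∫ ω, sqDist (X i ω) (Y ω) ∂P) l (𝓝 (∫ _ω, (0 : ℝ) ∂P)) := by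
    refine tendsto_integral_filter_of_dominated_convergence (fun _ => 4)
      (Eventually.of_forall fun i => (measurable_sqDist (hX i) hY).aestronglyMeasurable)
      (Eventually.of_forall fun i => Eventually.of_forall fun ω => ?_)
      (integrable_const _) ?_
    · rw [Real.norm_of_nonneg (sqDist_nonneg _ _)]; exact sqDist_le _ _
    · filter_upwards [hlim] with ω hω
      have h1 := (continuous_sqDist.tendsto (Y ω, Y ω)).comp (hω.prodMk_nhds tendsto_const_nhds)
      simpa [sqDist, Function.comp_def] using h1
  simpa using this

end Wasserstein

/-! ### Convergence of the iterates -/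

/-- The law of the limiting pair of magnetisations. -/
def limitLaw (d : ℝ) {β : ℝ} (hβ : 0 ≤ β) (B : ℝ) (t : unitInterval) : ProbabilityMeasure Square :=
  ⟨(gwMeasure d t).map (magLim β B),
    Measure.isProbabilityMeasure_map (μ := gwFrom d t 0) (measurable_magLim hβ B).aemeasurable⟩

instance (d : ℝ) (t : unitInterval) : IsProbabilityMeasure (gwMeasure d t) := by
  unfold gwMeasure; infer_instance

lemma bpIterate_eq_map {d : ℝ} (hd : 0 < d) (β B : ℝ) (t : unitInterval) (ℓ : ℕ) :
    (bpIterate d β B t ℓ : Measure Square) = (gwMeasure d t).map (mag β B ℓ) :=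
  (magLaw_eq_bpIterate hd β B t ℓ).symm

lemma tendsto_bpIterate {d : ℝ} (hd : 0 < d) {β : ℝ} (hβ : 0 ≤ β) (B : ℝ) (t : unitInterval) :
    Tendsto (fun ℓ => bpIterate d β B t ℓ) atTop (𝓝 (limitLaw d hβ B t)) := by
  rw [ProbabilityMeasure.tendsto_iff_forall_integral_tendsto]
  intro f
  have h1 : ∀ ℓ, ∫ x, f x ∂(bpIterate d β B t ℓ : Measure Square)
      = ∫ N, f (mag β B ℓ N) ∂(gwMeasure d t) := fun ℓ => by
    rw [bpIterate_eq_map hd]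
    exact integral_map (measurable_mag β B ℓ).aemeasurable
      f.continuous.measurable.aestronglyMeasurable
  have h2 : ∫ x, f x ∂(limitLaw d hβ B t : Measure Square)
      = ∫ N, f (magLim β B N) ∂(gwMeasure d t) :=
    integral_map (measurable_magLim hβ B).aemeasurable
      f.continuous.measurable.aestronglyMeasurable
  simp only [h1, h2]
  refine tendsto_integral_of_dominated_convergence (fun _ => ‖f‖)
    (fun ℓ => (f.continuous.measurable.comp (measurable_mag β B ℓ)).aestronglyMeasurable)
    (integrable_const _) (fun ℓ => Eventually.of_forall fun N => f.norm_coe_le_norm _)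
    (Eventually.of_forall fun N => (f.continuous.tendsto _).comp (tendsto_mag hβ B N))

lemma tendsto_wasserstein1_bpIterate {d : ℝ} (hd : 0 < d) {β : ℝ} (hβ : 0 ≤ β) (B : ℝ)
    (t : unitInterval) :
    Tendsto (fun ℓ => wasserstein1 (bpIterate d β B t ℓ) (limitLaw d hβ B t)) atTop (𝓝 0) := by
  have h1 := tendsto_integral_sqDist (P := gwMeasure d t) (measurable_mag β B)
    (measurable_magLim hβ B) (Eventually.of_forall (tendsto_mag hβ B))
  have h2 := ENNReal.tendsto_ofReal h1
  rw [ENNReal.ofReal_zero] at h2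
  exact tendsto_of_tendsto_of_tendsto_of_le_of_le tendsto_const_nhds h2 (fun _ => zero_le)
    (fun ℓ => wasserstein1_le (measurable_mag β B ℓ) (measurable_magLim hβ B)
      (bpIterate_eq_map hd β B t ℓ) rfl)

/-! ### Truncation error uniform in t -/

section DepthBound

lemma integral_mag_eq {d : ℝ} (hd : 0 < d) (β B : ℝ) (s t : unitInterval) (ℓ : ℕ) (h : Fin 2) :
    ∫ N, (mag β B ℓ N h : ℝ) ∂(gwMeasure d s) = ∫ N, (mag β B ℓ N h : ℝ) ∂(gwMeasure d t) := by
  have key : ∀ t, ∫ N, (mag β B ℓ N h : ℝ) ∂(gwMeasure d t) =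
      ∫ y : Set.Icc (-1 : ℝ) 1, (y : ℝ)
        ∂((plainBP d.toNNReal β B)^[ℓ] (Measure.dirac (corner h))) := by
    intro t
    rw [← magLaw_map_eval hd β B t h ℓ (Or.inl rfl), magLaw,
      Measure.map_map (by fun_prop) (measurable_mag β B ℓ),
      integral_map ((measurable_pi_apply h).comp (measurable_mag β B ℓ)).aemeasurable
        measurable_subtype_coe.aestronglyMeasurable]
    rfl
  rw [key s, key t]

lemma integrable_coord {Ω : Type*} [MeasurableSpace Ω] {P : Measure Ω} [IsProbabilityMeasure P]
    {X : Ω → Square} (hX : Measurable X) (h : Fin 2) : Integrable (fun ω => (X ω h : ℝ)) P :=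
  Integrable.of_bound (Measurable.aestronglyMeasurable (by fun_prop)) 1
    (Eventually.of_forall fun ω => abs_le.mpr (X ω h).2)

lemma integral_magLim_eq {d : ℝ} (hd : 0 < d) {β : ℝ} (hβ : 0 ≤ β) (B : ℝ) (s t : unitInterval)
    (h : Fin 2) :
    ∫ N, (magLim β B N h : ℝ) ∂(gwMeasure d s) = ∫ N, (magLim β B N h : ℝ) ∂(gwMeasure d t) := by
  have key : ∀ t, Tendsto (fun ℓ => ∫ N, (mag β B ℓ N h : ℝ) ∂(gwMeasure d t)) atTop
      (𝓝 (∫ N, (magLim β B N h : ℝ) ∂(gwMeasure d t))) := by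
    intro t
    refine tendsto_integral_of_dominated_convergence (fun _ => 1)
      (fun ℓ => (integrable_coord (measurable_mag β B ℓ) h).aestronglyMeasurable)
      (integrable_const _) (fun ℓ => Eventually.of_forall fun N => abs_le.mpr (mag β B ℓ N h).2)
      (Eventually.of_forall fun N => ?_)
    exact (continuous_subtype_val.tendsto _).comp (tendsto_pi_nhds.mp (tendsto_mag hβ B N) h)
  refine tendsto_nhds_unique (key s) ?_
  simp only [integral_mag_eq hd β B s t]
  exact key t

/-- The mean distance of the magnetisations at depth `ℓ` from their limit does not depend
on `t`. -/
lemma integral_sqDist_mag_eq {d : ℝ} (hd : 0 < d) {β : ℝ} (hβ : 0 ≤ β) (B : ℝ)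
    (s t : unitInterval) (ℓ : ℕ) :
    ∫ N, sqDist (mag β B ℓ N) (magLim β B N) ∂(gwMeasure d s)
      = ∫ N, sqDist (mag β B ℓ N) (magLim β B N) ∂(gwMeasure d t) := by
  have key : ∀ t, ∫ N, sqDist (mag β B ℓ N) (magLim β B N) ∂(gwMeasure d t) =
      ∑ h, (∫ N, (mag β B ℓ N h : ℝ) ∂(gwMeasure d t)
        - ∫ N, (magLim β B N h : ℝ) ∂(gwMeasure d t)) := by
    intro t
    -- The limit lies below every finite-depth value, so the absolute values disappear and the
    -- distance becomes linear in the coordinates.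
    have h1 : ∀ N, sqDist (mag β B ℓ N) (magLim β B N)
        = ∑ h, ((mag β B ℓ N h : ℝ) - (magLim β B N h : ℝ)) := fun N =>
      Finset.sum_congr rfl fun h _ => abs_of_nonneg (sub_nonneg.mpr (magLim_le_mag β B ℓ N h))
    simp only [h1]
    rw [integral_finsetSum (f := fun h N => (mag β B ℓ N h : ℝ) - (magLim β B N h : ℝ)) _
      fun h _ => (integrable_coord (measurable_mag β B ℓ) h).sub
        (integrable_coord (measurable_magLim hβ B) h)]
    exact Finset.sum_congr rfl fun h _ => integral_sub (integrable_coord (measurable_mag β B ℓ) h)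
      (integrable_coord (measurable_magLim hβ B) h)
  rw [key s, key t]
  simp only [integral_mag_eq hd β B s t, integral_magLim_eq hd hβ B s t]

end DepthBound

/-! ### Poisson quantile coupling -/

section Quantile

/-- The probability that a `Po(r)` variable is less than `k`. -/
def poissonPartial (r : ℝ≥0) (k : ℕ) : ℝ :=
  ∑ i ∈ Finset.range k, Real.exp (-r) * r ^ i / (i.factorial : ℝ)

lemma continuous_poissonPartial (k : ℕ) : Continuous fun r => poissonPartial r k := by
  unfold poissonPartial
  fun_prop

lemma poissonPartial_mono (r : ℝ≥0) : Monotone (poissonPartial r) :=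
  monotone_nat_of_le_succ fun k => by
    unfold poissonPartial
    rw [Finset.sum_range_succ]
    exact le_add_of_nonneg_right (by positivity)

lemma tendsto_poissonPartial (r : ℝ≥0) : Tendsto (poissonPartial r) atTop (𝓝 1) :=
  (hasSum_one_poissonMeasure r).tendsto_sum_nat

lemma poissonPartial_le_one (r : ℝ≥0) (k : ℕ) : poissonPartial r k ≤ 1 :=
  (poissonPartial_mono r).ge_of_tendsto (tendsto_poissonPartial r) k

lemma poissonPartial_nonneg (r : ℝ≥0) (k : ℕ) : 0 ≤ poissonPartial r k :=
  Finset.sum_nonneg fun _ _ => by positivity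

/-- The alternative `u = 1` keeps the quantile total: for positive `r` no partial sum reaches 1. -/
lemma exists_le_poissonPartial (r : ℝ≥0) (u : unitInterval) :
    ∃ k, (u : ℝ) ≤ poissonPartial r (k + 1) ∨ u = 1 := by
  by_cases hu : u = 1
  · exact ⟨0, Or.inr hu⟩
  · have hlt : (u : ℝ) < 1 := lt_of_le_of_ne u.2.2 fun h => hu (Subtype.ext h)
    obtain ⟨k, hk⟩ := ((tendsto_poissonPartial r).eventually_const_lt hlt).exists
    exact ⟨k, Or.inl (hk.le.trans (poissonPartial_mono r k.le_succ))⟩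

open Classical in
/-- The quantile function of the Poisson law. -/
def poissonQuantile (r : ℝ≥0) (u : unitInterval) : ℕ := Nat.find (exists_le_poissonPartial r u)

lemma measurable_poissonQuantile (r : ℝ≥0) : Measurable (poissonQuantile r) := by
  classical
  refine measurable_find _ fun k => ?_
  exact (measurableSet_le measurable_subtype_coe measurable_const).union (measurableSet_singleton 1)

lemma poissonQuantile_eq {r : ℝ≥0} {u : unitInterval} {k : ℕ} (h1 : poissonPartial r k < u)
    (h2 : (u : ℝ) < poissonPartial r (k + 1)) : poissonQuantile r u = k := by
  classical
  refine (Nat.find_eq_iff _).mpr ⟨Or.inl h2.le, fun j hj hcon => ?_⟩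
  rcases hcon with hcon | hcon
  · exact absurd (hcon.trans (poissonPartial_mono r (Nat.succ_le_of_lt hj))) (not_le.mpr h1)
  · rw [hcon] at h2
    exact absurd (poissonPartial_le_one r (k + 1)) (not_le.mpr h2)

/-- It suffices to bound atoms from one side, since both measures have mass one. Hence the endpoints
of the quantile intervals can be ignored. -/
lemma volume_map_poissonQuantile (r : ℝ≥0) :
    (volume : Measure unitInterval).map (poissonQuantile r) = poissonMeasure r := by
  have : IsProbabilityMeasure ((volume : Measure unitInterval).map (poissonQuantile r)) :=
    Measure.isProbabilityMeasure_map (measurable_poissonQuantile r).aemeasurable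
  refine (Measure.eq_of_le_of_isProbabilityMeasure ?_).symm
  have hsing : ∀ k, poissonMeasure r {k} ≤
      (volume : Measure unitInterval).map (poissonQuantile r) {k} := by
    intro k
    rw [Measure.map_apply (measurable_poissonQuantile r) (measurableSet_singleton k)]
    let a : unitInterval := ⟨_, poissonPartial_nonneg r k, poissonPartial_le_one r k⟩
    let b : unitInterval := ⟨_, poissonPartial_nonneg r (k + 1), poissonPartial_le_one r (k + 1)⟩
    have hvol : poissonMeasure r {k} = volume (Set.Ioo a b) := by
      rw [unitInterval.volume_Ioo, poissonMeasure_singleton]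
      congr 1
      simp only [a, b, poissonPartial, Finset.sum_range_succ, add_sub_cancel_left]
    rw [hvol]
    exact measure_mono fun u hu => poissonQuantile_eq hu.1 hu.2
  refine Measure.le_iff.mpr fun s _ => ?_
  rw [← Measure.tsum_indicator_apply_singleton _ _ s.to_countable.measurableSet,
    ← Measure.tsum_indicator_apply_singleton _ _ s.to_countable.measurableSet]
  exact ENNReal.tsum_le_tsum fun k => Set.indicator_le_indicator (hsing k)

/-- Outside the countable set of partial sums and the point 1, `u` lies strictly between two
consecutive partial sums, an open condition in the rate. -/
lemma ae_eventually_poissonQuantile_eq (r : ℝ≥0) :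
    ∀ᵐ u : unitInterval, ∀ᶠ r' in 𝓝 r, poissonQuantile r' u = poissonQuantile r u := by
  classical
  have hnull : ∀ a : unitInterval, ∀ᵐ u : unitInterval, u ≠ a := fun a => by
    rw [ae_iff]
    simp
  have hpart : ∀ᵐ u : unitInterval, ∀ k, (u : ℝ) ≠ poissonPartial r k := by
    rw [ae_all_iff]
    intro k
    filter_upwards [hnull ⟨_, poissonPartial_nonneg r k, poissonPartial_le_one r k⟩] with u hu h
    exact hu (Subtype.ext h)
  filter_upwards [hnull 1, hpart] with u h1 hu
  set k := poissonQuantile r u with hk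
  have hfind := (Nat.find_eq_iff (exists_le_poissonPartial r u)).mp hk.symm
  have hhi : (u : ℝ) < poissonPartial r (k + 1) :=
    lt_of_le_of_ne (hfind.1.resolve_right h1) (hu _)
  have hlo : poissonPartial r k < u := by
    refine lt_of_le_of_ne ?_ (hu k).symm
    rcases Nat.eq_zero_or_pos k with h0 | hpos
    · rw [h0]; simpa [poissonPartial] using u.2.1
    -- Minimality of `k` is applied at its predecessor, whose defining inequality involves the
    -- partial sum at `k`.
    · have := hfind.2 (k - 1) (by omega)
      rw [Nat.sub_add_cancel hpos] at this
      push Not at this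
      exact this.1.le
  filter_upwards [(continuous_poissonPartial k).continuousAt.eventually_lt_const hlo,
    (continuous_poissonPartial (k + 1)).continuousAt.eventually_const_lt hhi] with r' h2 h3
  exact poissonQuantile_eq h2 h3

end Quantile

/-! ### Continuity in t -/

section Continuity

/-- Offspring numbers for all `t` simultaneously, obtained from uniform variables. -/
def quantileOffspring (d : ℝ) (t : unitInterval) (ω : Word × Fin 3 → unitInterval) : Offspring :=
  fun p => poissonQuantile (offspringRate d t (vertexType p.1) p.2) (ω p)

lemma measurable_quantileOffspring (d : ℝ) (t : unitInterval) :
    Measurable (quantileOffspring d t) :=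
  measurable_pi_lambda _ fun p => (measurable_poissonQuantile _).comp (measurable_pi_apply p)

/-- The law of a family of independent uniform variables. -/
def uniformLaw : Measure (Word × Fin 3 → unitInterval) := Measure.infinitePi fun _ => volume

instance : IsProbabilityMeasure uniformLaw := by unfold uniformLaw; infer_instance

lemma uniformLaw_map_quantileOffspring (d : ℝ) (t : unitInterval) :
    uniformLaw.map (quantileOffspring d t) = gwMeasure d t := by
  refine (Measure.infinitePi_map_pi _ (f := fun p : Word × Fin 3 =>
    poissonQuantile (offspringRate d t (vertexType p.1) p.2))
    fun p => measurable_poissonQuantile _).trans ?_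
  simp only [volume_map_poissonQuantile]
  rfl

lemma continuous_offspringRate (d : ℝ) (σ τ : Fin 3) :
    Continuous fun t : unitInterval => offspringRate d t σ τ := by
  refine continuous_real_toNNReal.comp ?_
  fin_cases σ <;> fin_cases τ <;> simp <;> fun_prop

lemma ae_eventually_quantileOffspring_eq (d : ℝ) (s : unitInterval) :
    ∀ᵐ ω ∂uniformLaw, ∀ p, ∀ᶠ t in 𝓝 s, quantileOffspring d t ω p = quantileOffspring d s ω p := by
  rw [ae_all_iff]
  intro p
  have hmp := measurePreserving_eval_infinitePi
    (fun _ : Word × Fin 3 => (volume : Measure unitInterval)) p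
  filter_upwards [hmp.quasiMeasurePreserving.ae (ae_eventually_poissonQuantile_eq
    (offspringRate d s (vertexType p.1) p.2))] with ω hω
  exact (continuous_offspringRate d (vertexType p.1) p.2).continuousAt.eventually hω

lemma bpMap_congr (β B : ℝ) {n : Fin 3 → ℕ} {x y : Fin 3 × ℕ → Square}
    (hxy : ∀ τ, ∀ i < n τ, x (τ, i) = y (τ, i)) : bpMap β B (n, x) = bpMap β B (n, y) := by
  have hw : ∀ h s, bpWeight β B (n, x) h s = bpWeight β B (n, y) h s := by
    intro h s
    have hprod : ∀ τ, ∏ i ∈ Finset.range (n τ), (1 + s * (x (τ, i) h : ℝ) * Real.tanh β) =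
        ∏ i ∈ Finset.range (n τ), (1 + s * (y (τ, i) h : ℝ) * Real.tanh β) := fun τ =>
      Finset.prod_congr rfl fun i hi => by rw [hxy τ i (Finset.mem_range.mp hi)]
    simp only [bpWeight, hprod]
  funext h
  apply Subtype.ext
  simp only [bpMap, bpRatio, hw]

/-- For the limiting tree `M` only finitely many offspring numbers are read up to depth `ℓ`, so
finitely many eventual equalities are intersected. -/
lemma eventually_mag_eq (β B : ℝ) {ι : Type*} {l : Filter ι} (ℓ : ℕ) {N : ι → Offspring}
    {M : Offspring} (hN : ∀ p, ∀ᶠ i in l, N i p = M p) :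
    ∀ᶠ i in l, mag β B ℓ (N i) = mag β B ℓ M := by
  induction ℓ generalizing N M with
  | zero => exact Eventually.of_forall fun _ => rfl
  | succ ℓ ih =>
    have hroot : ∀ᶠ i in l, ∀ τ, N i ([], τ) = M ([], τ) :=
      eventually_all.mpr fun τ => hN ([], τ)
    have hsub : ∀ᶠ i in l, ∀ τ, ∀ j ∈ Finset.range (M ([], τ)),
        mag β B ℓ (shift (τ, j) (N i)) = mag β B ℓ (shift (τ, j) M) :=
      eventually_all.mpr fun τ => (Finset.eventually_all _).mpr fun j _ =>
        ih fun p => hN ((τ, j) :: p.1, p.2)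
    filter_upwards [hroot, hsub] with i h1 h2
    simp only [mag, h1]
    exact bpMap_congr β B fun τ j hj => h2 τ j (Finset.mem_range.mpr hj)

lemma tendsto_wasserstein1_limitLaw {d : ℝ} (hd : 0 < d) {β : ℝ} (hβ : 0 ≤ β) (B : ℝ)
    (s : unitInterval) :
    Tendsto (fun t => wasserstein1 (limitLaw d hβ B t) (limitLaw d hβ B s)) (𝓝 s) (𝓝 0) := by
  set Q := fun t => quantileOffspring d t
  have hQ : ∀ t, Measurable (Q t) := measurable_quantileOffspring d
  have hmL := measurable_magLim hβ B
  have hL : ∀ t, Measurable fun ω => magLim β B (Q t ω) := fun t => hmL.comp (hQ t)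
  have hM : ∀ ℓ t, Measurable fun ω => mag β B ℓ (Q t ω) := fun ℓ t =>
    (measurable_mag β B ℓ).comp (hQ t)
  have hlaw : ∀ t, (limitLaw d hβ B t : Measure Square)
      = uniformLaw.map fun ω => magLim β B (Q t ω) := by
    intro t
    change (gwMeasure d t).map (magLim β B) = _
    rw [← uniformLaw_map_quantileOffspring, Measure.map_map hmL (hQ t)]
    rfl
  have hI : Tendsto (fun t => ∫ ω, sqDist (magLim β B (Q t ω)) (magLim β B (Q s ω)) ∂uniformLaw)
      (𝓝 s) (𝓝 0) := by
    set ε : ℕ → ℝ := fun ℓ => ∫ N, sqDist (mag β B ℓ N) (magLim β B N) ∂(gwMeasure d s)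
    have hε : Tendsto ε atTop (𝓝 0) := tendsto_integral_sqDist (measurable_mag β B) hmL
      (Eventually.of_forall (tendsto_mag hβ B))
    have hεt : ∀ ℓ t, ∫ ω, sqDist (mag β B ℓ (Q t ω)) (magLim β B (Q t ω)) ∂uniformLaw = ε ℓ := by
      intro ℓ t
      simp only [ε]
      rw [← integral_sqDist_mag_eq hd hβ B t s ℓ, ← uniformLaw_map_quantileOffspring d t,
        integral_map (hQ t).aemeasurable
          (measurable_sqDist (measurable_mag β B ℓ) hmL).aestronglyMeasurable]
    have hfin : ∀ ℓ, Tendsto (fun t => ∫ ω, sqDist (mag β B ℓ (Q t ω)) (mag β B ℓ (Q s ω))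
        ∂uniformLaw) (𝓝 s) (𝓝 0) := by
      intro ℓ
      refine tendsto_integral_sqDist (hM ℓ) (hM ℓ s) ?_
      filter_upwards [ae_eventually_quantileOffspring_eq d s] with ω hω
      exact tendsto_const_nhds.congr' ((eventually_mag_eq β B ℓ hω).mono fun t ht => ht.symm)
    -- Truncate at depth `ℓ` at both parameters: the outer errors are the same `ε ℓ`, and the middle
    -- term vanishes as `t` tends to `s`.
    have hbound : ∀ ℓ t, ∫ ω, sqDist (magLim β B (Q t ω)) (magLim β B (Q s ω)) ∂uniformLaw ≤
        ε ℓ + ∫ ω, sqDist (mag β B ℓ (Q t ω)) (mag β B ℓ (Q s ω)) ∂uniformLaw + ε ℓ := by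
      intro ℓ t
      have i1 := integrable_sqDist (P := uniformLaw) (hM ℓ t) (hL t)
      have i2 := integrable_sqDist (P := uniformLaw) (hM ℓ t) (hM ℓ s)
      have i3 := integrable_sqDist (P := uniformLaw) (hM ℓ s) (hL s)
      have i12 : Integrable (fun ω => sqDist (mag β B ℓ (Q t ω)) (magLim β B (Q t ω))
          + sqDist (mag β B ℓ (Q t ω)) (mag β B ℓ (Q s ω))) uniformLaw := i1.add i2
      have hsum : ∫ ω, (sqDist (mag β B ℓ (Q t ω)) (magLim β B (Q t ω))
          + sqDist (mag β B ℓ (Q t ω)) (mag β B ℓ (Q s ω))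
          + sqDist (mag β B ℓ (Q s ω)) (magLim β B (Q s ω))) ∂uniformLaw =
          ε ℓ + ∫ ω, sqDist (mag β B ℓ (Q t ω)) (mag β B ℓ (Q s ω)) ∂uniformLaw + ε ℓ := by
        rw [integral_add i12 i3, integral_add i1 i2, hεt, hεt]
      rw [← hsum]
      refine integral_mono (integrable_sqDist (hL t) (hL s)) (i12.add i3) fun ω => ?_
      have h1 := sqDist_triangle (magLim β B (Q t ω)) (mag β B ℓ (Q t ω)) (magLim β B (Q s ω))
      have h2 := sqDist_triangle (mag β B ℓ (Q t ω)) (mag β B ℓ (Q s ω)) (magLim β B (Q s ω))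
      rw [sqDist_comm (magLim β B (Q t ω)) (mag β B ℓ (Q t ω))] at h1
      linarith
    rw [tendsto_order]
    refine ⟨fun a ha => Eventually.of_forall fun t =>
      lt_of_lt_of_le ha (integral_nonneg fun ω => sqDist_nonneg _ _), fun a ha => ?_⟩
    obtain ⟨ℓ, hℓ⟩ := (hε.eventually_lt_const (show 0 < a / 3 by linarith)).exists
    filter_upwards [(hfin ℓ).eventually_lt_const (show 0 < a / 3 by linarith)] with t ht
    linarith [hbound ℓ t]
  have h2 := ENNReal.tendsto_ofReal hI
  rw [ENNReal.ofReal_zero] at h2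
  exact tendsto_of_tendsto_of_tendsto_of_le_of_le tendsto_const_nhds h2 (fun _ => zero_le)
    (fun t => wasserstein1_le (hL t) (hL s) (hlaw t) (hlaw s))

end Continuity

/-! ### Transfer to the plane and conclusion -/

/-- The inclusion of the square into the plane. -/
def squareVal (x : Square) : Fin 2 → ℝ := fun h => (x h : ℝ)

lemma continuous_squareVal : Continuous squareVal := by
  unfold squareVal
  fun_prop

end CoupledIsing

end

theorem proposition2p5 (d β B : ℝ) (hd : 0 < d) (hβ : 0 < β) (hB : 0 ≤ B) :
    ∃ π : unitInterval → ProbabilityMeasure CoupledIsing.Square,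
      -- the weak limit exists, and the convergence takes place in the Wasserstein distance
      (∀ t, Tendsto (fun ℓ => CoupledIsing.bpIterate d β B t ℓ) atTop (𝓝 (π t))) ∧
      (∀ t, Tendsto (fun ℓ => CoupledIsing.wasserstein1 (CoupledIsing.bpIterate d β B t ℓ) (π t))
        atTop (𝓝 0)) ∧
      -- the iterates are the laws of the pairs of root magnetisations at finite depth
      (∀ t ℓ, HasLaw (CoupledIsing.treeMagnetisation β B ℓ)
        (CoupledIsing.toPlane (CoupledIsing.bpIterate d β B t ℓ)) (CoupledIsing.gwMeasure d t)) ∧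
      -- these pairs converge almost surely, and the limit is the law of their limit
      (∀ t, ∃ R : CoupledIsing.Offspring → Fin 2 → ℝ,
        (∀ᵐ N ∂(CoupledIsing.gwMeasure d t),
          Tendsto (fun ℓ => CoupledIsing.treeMagnetisation β B ℓ N) atTop (𝓝 (R N))) ∧
        HasLaw R (CoupledIsing.toPlane (π t)) (CoupledIsing.gwMeasure d t)) ∧
      -- continuity in the Wasserstein distance
      (∀ s, Tendsto (fun t => CoupledIsing.wasserstein1 (π t) (π s)) (𝓝 s) (𝓝 0)) := by
  open CoupledIsing in
  refine ⟨limitLaw d hβ.le B, tendsto_bpIterate hd hβ.le B,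
    tendsto_wasserstein1_bpIterate hd hβ.le B, fun t ℓ => ?_,
    fun t => ⟨fun N => squareVal (magLim β B N), ?_, ?_⟩,
    tendsto_wasserstein1_limitLaw hd hβ.le B⟩
  -- Measurability is available for the recursion `mag`; the Ising magnetisation inherits the law by
  -- almost sure equality.
  · have hmag : HasLaw (fun N => squareVal (mag β B ℓ N)) (toPlane (bpIterate d β B t ℓ))
        (gwMeasure d t) :=
      ⟨(continuous_squareVal.measurable.comp (measurable_mag β B ℓ)).aemeasurable, by
        rw [toPlane, bpIterate_eq_map hd]
        exact (Measure.map_map continuous_squareVal.measurable (measurable_mag β B ℓ)).symm⟩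
    refine hmag.congr ?_
    filter_upwards [ae_typeConsistent d t] with N hN
    exact hN.treeMagnetisation_eq β B ℓ
  · filter_upwards [ae_typeConsistent d t] with N hN
    simp only [hN.treeMagnetisation_eq β B]
    exact (continuous_squareVal.tendsto _).comp (tendsto_mag hβ.le B N)
  · exact ⟨(continuous_squareVal.measurable.comp (measurable_magLim hβ.le B)).aemeasurable,
      (Measure.map_map continuous_squareVal.measurable (measurable_magLim hβ.le B)).symm⟩
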